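/- **Setting (continual supervised learning).** Let $\mathcal{Y}$ be a nonempty finite set of labels, and let $\mathcal{X}$ (inputs) and $\mathcal{U}$ (agent states) be nonempty standard Borel spaces. Let $\Delta_{\mathcal{Y}}$ be the simplex of probability vectors on $\mathcal{Y}$. On a probability space there are observations $O_t=(Y_t,X_t)\in\mathcal{Y}\times\mathcal{X}$, where $Y_{t+1}$ is the label assigned to the input $X_t$, actions $A_t\in\Delta_{\mathcal{Y}}$, and agent states $U_t\in\mathcal{U}$, for $t\in\mathbb{Z}_+=\{0,1,2,\dots\}$. Write $H_t=(O_0,\dots,O_t)$ and $H_{s:\infty}=(O_s,O_{s+1},\dots)$. There are probability kernels $\pi,\psi,\rho$ such that for every $t\in\mathbb{Z}_+$: * conditionally on $(O_{0:t},U_{0:t},A_{0:t-1})$, the action $A_t$ has law $\pi(\cdot\mid U_t)$; * conditionally on $(O_{0:t},U_{0:t},A_{0:t})$, the observation $O_{t+1}$ has law $\rho(\cdot\mid H_t)$; * conditionally on $(O_{0:t+1},U_{0:t},A_{0:t})$, the state $U_{t+1}$ has law $\psi(\cdot\mid U_t,A_t,O_{t+1})$. Let $P^*_t=\mathbb{P}(Y_{t+1}\in\cdot\mid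 H_t)$ and $\tilde P_t=\mathbb{P}(Y_{t+1}\in\cdot\mid U_t)$. The informational error at time $t$ is $\mathbb{E}[\mathbf{d}_{\rm KL}(P^*_t\,\|\,\tilde P_t)]$. The conditional mutual information $\mathbb{I}(B;C\mid D)\in[0,\infty]$ is the KL divergence of the joint law of $(D,B,C)$ from $\mathbb{P}_D\otimes(\mathbb{P}_{B\mid D}\times\mathbb{P}_{C\mid D})$. **Theorem.** Suppose that $((U_t,O_t):t\in\mathbb{Z}_+)$ is a stationary process and that, for every $t\in\mathbb{Z}_+$, the input $X_{t+1}$ is independent of the data observed before it, that is, of $(H_t,Y_{t+1})$. Then both limits below exist, are finite, and are equal: $$\lim_{t\to\infty}\underbrace{\mathbb{E}\big[\mathbf{d}_{\rm KL}(P^*_t\,\|\,\tilde P_t)\big]}_{\text{error}}=\lim_{t\to\infty}\Big(\underbrace{\mathbb{I}(H_{t+1:\infty};U_{t-1}\mid U_t,O_t)}_{\text{forgetting}}+\underbrace{\mathbb{I}(H_{t+1:\infty};O_t\mid U_t)}_{\text{implasticity}}\Big).$$ -/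

import Mathlib

open MeasureTheory ProbabilityTheory Filter Topology
open scoped ENNReal NNReal

noncomputable section

namespace ContinualSL

variable {Ω α β γ δ : Type*} [MeasurableSpace Ω]
  [MeasurableSpace α] [MeasurableSpace β] [MeasurableSpace γ] [MeasurableSpace δ]

/-- The block `(Z_i : i ∈ s)` of a process `Z`. -/
def block (Z : ℕ → Ω → α) (s : Finset ℕ) (ω : Ω) : s → α := fun i => Z i ω

/-- The data `(Z_0, …, Z_t)` observed through time `t`. For the observation process this is the
history `H_t`. -/
abbrev history (Z : ℕ → Ω → α) (t : ℕ) : Ω → (Finset.Iic t → α) := block Z (Finset.Iic t)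

/-- The data `H_{s:∞} = (Z_s, Z_{s+1}, …)`. -/
def future (Z : ℕ → Ω → α) (s : ℕ) (ω : Ω) : ℕ → α := fun i => Z (s + i) ω

/-- A process indexed by `ℕ` is (strictly) stationary when its law is invariant under all time
shifts. -/
def IsStationary (Z : ℕ → Ω → α) (μ : Measure Ω) : Prop :=
  ∀ s : ℕ, μ.map (fun ω t => Z (s + t) ω) = μ.map (fun ω t => Z t ω)

/-- Conditional mutual information `I(B; C | D)` in nats: the Kullback-Leibler divergence from the
joint law of `(D, B, C)` to the law under which `D` has its own law and, given `D`, the variables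
`B` and `C` are independent with their conditional laws given `D`. -/
def condMutualInfo [StandardBorelSpace β] [Nonempty β] [StandardBorelSpace γ] [Nonempty γ]
    (B : Ω → β) (C : Ω → γ) (D : Ω → δ) (μ : Measure Ω) [IsFiniteMeasure μ] : ℝ≥0∞ :=
  InformationTheory.klDiv (μ.map fun ω => (D ω, B ω, C ω))
    (μ.map D ⊗ₘ (condDistrib B D μ ×ₖ condDistrib C D μ))

end ContinualSL

namespace ContinualSL

variable {Ω 𝒳 𝒴 𝒰 : Type*} [MeasurableSpace Ω]
  [MeasurableSpace 𝒳] [MeasurableSpace 𝒴] [Fintype 𝒴] [MeasurableSpace 𝒰]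

/-- Continual supervised learning. The observation `O t = (Y_t, X_t)` is a label and the next input;
the action `A t` is a point of the simplex of predictive distributions over labels; `U t` is the
agent state. Each variable is drawn in turn, given everything generated before it:
* `A_t ∼ π(· | U_t)`;
* `O_{t+1} ∼ ρ(· | H_t)`, which depends on the past through past observations only;
* `U_{t+1} ∼ ψ(· | U_t, A_t, O_{t+1})`. -/
structure IsSupervisedInteraction (μ : Measure Ω)
    (ρ : ∀ t : ℕ, Kernel (Finset.Iic t → 𝒴 × 𝒳) (𝒴 × 𝒳))
    (π : Kernel 𝒰 (stdSimplex ℝ 𝒴))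
    (ψ : Kernel (𝒰 × stdSimplex ℝ 𝒴 × (𝒴 × 𝒳)) 𝒰)
    (O : ℕ → Ω → 𝒴 × 𝒳) (A : ℕ → Ω → stdSimplex ℝ 𝒴) (U : ℕ → Ω → 𝒰) : Prop where
  measurable_obs : ∀ t, Measurable (O t)
  measurable_action : ∀ t, Measurable (A t)
  measurable_state : ∀ t, Measurable (U t)
  action_law : ∀ t, HasCondDistrib (A t)
    (fun ω => (history O t ω, history U t ω, block A (Finset.Iio t) ω))
    (π.comap (fun p => p.2.1 ⟨t, Finset.mem_Iic.2 le_rfl⟩) (by fun_prop)) μ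
  obs_law : ∀ t, HasCondDistrib (O (t + 1))
    (fun ω => (history O t ω, history U t ω, history A t ω))
    ((ρ t).comap (fun p => p.1) (by fun_prop)) μ
  state_law : ∀ t, HasCondDistrib (U (t + 1))
    (fun ω => (history O (t + 1) ω, history U t ω, history A t ω))
    (ψ.comap (fun p => (p.2.1 ⟨t, Finset.mem_Iic.2 le_rfl⟩, p.2.2 ⟨t, Finset.mem_Iic.2 le_rfl⟩,
      p.1 ⟨t + 1, Finset.mem_Iic.2 le_rfl⟩)) (by fun_prop)) μ

variable [MeasurableSingletonClass 𝒴] [Nonempty 𝒴]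

/-- The informational error `𝔼[d_KL(P*_t ‖ P̃_t)]`, where `P*_t = ℙ(Y_{t+1} ∈ · | H_t)` and
`P̃_t = ℙ(Y_{t+1} ∈ · | U_t)`. -/
def informationalError (O : ℕ → Ω → 𝒴 × 𝒳) (U : ℕ → Ω → 𝒰) (μ : Measure Ω) [IsFiniteMeasure μ]
    (t : ℕ) : ℝ≥0∞ :=
  ∫⁻ ω, InformationTheory.klDiv
    (condDistrib (fun ω' => (O (t + 1) ω').1) (history O t) μ (history O t ω))
    (condDistrib (fun ω' => (O (t + 1) ω').1) (U t) μ (U t ω)) ∂μ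

variable [StandardBorelSpace 𝒳] [Nonempty 𝒳] [StandardBorelSpace 𝒰] [Nonempty 𝒰]

/-- The forgetting term `I(H_{t+1:∞}; U_{t-1} | U_t, O_t)`. There is no state before time `0`
(`U_{-1}` is trivial), so the term vanishes at `t = 0`. -/
def forgetting (O : ℕ → Ω → 𝒴 × 𝒳) (U : ℕ → Ω → 𝒰) (μ : Measure Ω) [IsFiniteMeasure μ] :
    ℕ → ℝ≥0∞
  | 0 => 0
  | t + 1 => condMutualInfo (future O (t + 2)) (U t) (fun ω => (U (t + 1) ω, O (t + 1) ω)) μ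

/-- The implasticity term `I(H_{t+1:∞}; O_t | U_t)`. -/
def implasticity (O : ℕ → Ω → 𝒴 × 𝒳) (U : ℕ → Ω → 𝒰) (μ : Measure Ω) [IsFiniteMeasure μ]
    (t : ℕ) : ℝ≥0∞ :=
  condMutualInfo (future O (t + 1)) (O t) (U t) μ

end ContinualSL

end

/-!
All the information is carried by the labels. Write `h n` for the entropy of a label given the `n`
observations before it and the agent state before those (`stateEntropy`), and `g n` for its entropy
given the `n` observations before it (`dataEntropy`). By stationarity neither depends on time.

Given the data, the agent state says nothing more about the next label, so the informational error
at time `t` is `h 0 - g (t + 1)`.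

On the other side, the future observations are cut off at a horizon `n`. The chain rule
(`condMutualInfo_prodMk_left`) splits each information term into contributions of single labels and
single inputs. Every input is independent of all earlier data, of the earlier states and of the
simultaneous label, so it contributes nothing, and each label contributes a difference of
conditional entropies (`condMutualInfo_segment`). In the sum of forgetting and implasticity the
entropies given the new state and the new observation cancel. Moreover the new state is produced
from the old state and the new observation by independent randomization, so it may be dropped when
these are given (`condEntropy_update`). What remains is `∑ j < n, (h j - h (j + 1)) = h 0 - h n`.
The divergence defining an information about an infinite sequence is the limit of its finite-horizon versions
(`klDiv_le_of_forall_klDiv_map_le`), so for `t ≥ 1` the sum of forgetting and implasticity is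
`h 0 - lim h`.

Finally `g (n + 1) ≤ h n ≤ g n`: a state helps to predict, but no more than the data it was computed
from. As `g` is decreasing and nonnegative, `h` and `g` have a common finite limit.
-/

/-! ### Conditional distributions -/

namespace ProbabilityTheory

variable {Ω β γ δ : Type*} {mΩ : MeasurableSpace Ω}
  {mβ : MeasurableSpace β} {mγ : MeasurableSpace γ} {mδ : MeasurableSpace δ} {μ : Measure Ω}
  {B : Ω → β} {C : Ω → γ} {D : Ω → δ}

lemma hasCondDistrib_condDistrib [IsFiniteMeasure μ] [StandardBorelSpace β] [Nonempty β]
    (hB : Measurable B) (hD : Measurable D) : HasCondDistrib B D (condDistrib B D μ) μ :=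
  ⟨(hD.prodMk hB).aemeasurable, (compProd_map_condDistrib hB.aemeasurable).symm⟩

lemma HasCondDistrib.condDistrib_ae_eq [IsFiniteMeasure μ] [StandardBorelSpace β] [Nonempty β]
    {κ : Kernel δ β} [IsFiniteKernel κ] (h : HasCondDistrib B D κ μ) :
    condDistrib B D μ =ᵐ[μ.map D] κ :=
  condDistrib_ae_eq_of_measure_eq_compProd D h.aemeasurable_snd h.map_eq

/-- If the conditional law of `B` given `D` is a function of `f D`, it is also the conditional law
of `B` given `f D`. -/
lemma HasCondDistrib.of_comp [SFinite μ] {κ : Kernel δ β} [IsSFiniteKernel κ] {κ' : Kernel γ β}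
    [IsSFiniteKernel κ'] (h : HasCondDistrib B D κ μ) {f : δ → γ} (hf : Measurable f)
    (hκ : ∀ d, κ d = κ' (f d)) (hC : ∀ ω, f (D ω) = C ω) : HasCondDistrib B C κ' μ := by
  obtain rfl : f ∘ D = C := funext hC
  obtain rfl : κ = κ'.comap f hf := Kernel.ext hκ
  exact h.comp_right

/-- Two successive draws: if `B` has law `κ` given `D`, and `C` has law `η` given `(D, B)`, then
`(B, C)` has law `κ ⊗ₖ η` given `D`. -/
lemma HasCondDistrib.prodMk_compProd [SFinite μ] {κ : Kernel δ β} [IsSFiniteKernel κ]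
    {η : Kernel (δ × β) γ} [IsSFiniteKernel η] (hB : HasCondDistrib B D κ μ)
    (hC : HasCondDistrib C (fun ω => (D ω, B ω)) η μ) :
    HasCondDistrib (fun ω => (B ω, C ω)) D (κ ⊗ₖ η) μ where
  aemeasurable := by fun_prop
  map_eq := by
    rw [← Measure.compProd_assoc', ← hB.map_eq, ← hC.map_eq,
      AEMeasurable.map_map_of_aemeasurable (by fun_prop) (by fun_prop)]
    rfl

/-- Symmetry of conditional independence: if the conditional law of `C` given `(D, B)` depends on
`D` only, then further conditioning on `C` does not change the conditional law of `B` given `D`. -/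
lemma HasCondDistrib.swap [SFinite μ] {κ : Kernel δ β} [IsMarkovKernel κ]
    {η : Kernel δ γ} [IsMarkovKernel η] (hB : HasCondDistrib B D κ μ)
    (hC : HasCondDistrib C (fun ω => (D ω, B ω)) (η.prodMkRight β) μ) :
    HasCondDistrib B (fun ω => (D ω, C ω)) (κ.prodMkRight γ) μ where
  aemeasurable := by fun_prop
  map_eq := by
    have hCD : HasCondDistrib C D η μ := HasCondDistrib.comp_right (f := Prod.fst) hC
    have h1 : μ.map (fun ω => ((D ω, C ω), B ω))
        = (μ.map (fun ω => ((D ω, B ω), C ω))).map (fun p => ((p.1.1, p.2), p.1.2)) := by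
      rw [AEMeasurable.map_map_of_aemeasurable (by fun_prop) (by fun_prop)]
      rfl
    rw [h1, hC.map_eq, hB.map_eq, hCD.map_eq]
    refine Measure.ext_of_lintegral _ fun f hf => ?_
    rw [lintegral_map hf (by fun_prop), Measure.lintegral_compProd (by fun_prop),
      Measure.lintegral_compProd (by fun_prop), Measure.lintegral_compProd hf,
      Measure.lintegral_compProd (by fun_prop)]
    refine lintegral_congr fun d => ?_
    simp only [Kernel.prodMkRight_apply]
    exact lintegral_lintegral_swap (by fun_prop)

lemma HasCondDistrib.congr_kernel [SFinite μ] {κ κ' : Kernel δ β} [IsSFiniteKernel κ]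
    [IsSFiniteKernel κ'] (h : HasCondDistrib B D κ μ) (hκ : κ =ᵐ[μ.map D] κ') :
    HasCondDistrib B D κ' μ :=
  ⟨h.aemeasurable, by rw [h.map_eq, Measure.compProd_congr hκ]⟩

lemma hasCondDistrib_const_of_indepFun [IsProbabilityMeasure μ] (hB : Measurable B)
    (hD : Measurable D) (h : IndepFun B D μ) :
    HasCondDistrib B D (Kernel.const δ (μ.map B)) μ where
  aemeasurable := (hD.prodMk hB).aemeasurable
  map_eq := by
    have := Measure.isProbabilityMeasure_map (μ := μ) hB.aemeasurable
    rw [Measure.compProd_const]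
    exact (indepFun_iff_map_prod_eq_prod_map_map hD.aemeasurable hB.aemeasurable).1 h.symm

lemma hasCondDistrib_of_subsingleton [IsProbabilityMeasure μ] [Subsingleton β] (b : β)
    (hD : Measurable D) : HasCondDistrib B D (Kernel.const δ (Measure.dirac b)) μ where
  aemeasurable := (hD.prodMk (measurable_of_subsingleton_codomain B)).aemeasurable
  map_eq := by
    have hB : B = fun _ => b := Subsingleton.elim _ _
    rw [Measure.compProd_const, hB, Measure.prod_dirac, Measure.map_map (by fun_prop) hD]
    rfl

end ProbabilityTheory

/-! ### Kullback-Leibler divergence along a filtration -/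

namespace InformationTheory

lemma mul_log_sub_one_le_klFun (x : ℝ) : x * (Real.log x - 1) ≤ klFun x := by
  rw [klFun_apply]; linarith

/-- Nonnegative functions whose `klFun` integrals are bounded are uniformly integrable, because
`klFun` grows faster than linearly. -/
lemma uniformIntegrable_of_lintegral_klFun_le {α : Type*} {mα : MeasurableSpace α}
    {Q : Measure α} [IsFiniteMeasure Q] {f : ℕ → α → ℝ} (hf : ∀ n, Measurable (f n))
    (hf0 : ∀ n x, 0 ≤ f n x) {K : ℝ≥0}
    (hK : ∀ n, ∫⁻ x, ENNReal.ofReal (klFun (f n x)) ∂Q ≤ K) :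
    UniformIntegrable f 1 Q := by
  refine uniformIntegrable_of le_rfl ENNReal.one_ne_top
    (fun n => (hf n).aestronglyMeasurable) fun ε hε => ?_
  -- beyond `exp (1 + c)` one has `c * x ≤ klFun x`, and `c` is chosen with `K ≤ c * ε`
  set c : ℝ := (K + 1) / ε with hc
  have hcpos : 0 < c := by positivity
  refine ⟨⟨Real.exp (1 + c), (Real.exp_pos _).le⟩, fun n => ?_⟩
  rw [eLpNorm_one_eq_lintegral_enorm]
  have hpt : ∀ x, ‖({x | (⟨Real.exp (1 + c), (Real.exp_pos _).le⟩ : ℝ≥0) ≤ ‖f n x‖₊}.indicator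
      (f n)) x‖ₑ ≤ ENNReal.ofReal (1 / c) * ENNReal.ofReal (klFun (f n x)) := by
    intro x
    by_cases hx : x ∈ {x | (⟨Real.exp (1 + c), (Real.exp_pos _).le⟩ : ℝ≥0) ≤ ‖f n x‖₊}
    · rw [Set.indicator_of_mem hx, ← ENNReal.ofReal_mul (by positivity),
        Real.enorm_eq_ofReal (hf0 n x)]
      refine ENNReal.ofReal_le_ofReal ?_
      have hx' : Real.exp (1 + c) ≤ f n x := by
        have : ((⟨Real.exp (1 + c), (Real.exp_pos _).le⟩ : ℝ≥0) : ℝ) ≤ ‖f n x‖₊ := by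
          exact_mod_cast hx
        simpa [abs_of_nonneg (hf0 n x)] using this
      have hlog : 1 + c ≤ Real.log (f n x) :=
        (Real.le_log_iff_exp_le ((Real.exp_pos _).trans_le hx')).2 hx'
      have h1 := mul_log_sub_one_le_klFun (f n x)
      rw [one_div, ← div_eq_inv_mul, le_div_iff₀ hcpos]
      nlinarith [hf0 n x]
    · rw [Set.indicator_of_notMem hx]
      simp
  calc _ ≤ ∫⁻ x, ENNReal.ofReal (1 / c) * ENNReal.ofReal (klFun (f n x)) ∂Q := lintegral_mono hpt
    _ = ENNReal.ofReal (1 / c) * ∫⁻ x, ENNReal.ofReal (klFun (f n x)) ∂Q := by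
      rw [lintegral_const_mul]
      exact (measurable_klFun.comp (hf n)).ennreal_ofReal
    _ ≤ ENNReal.ofReal (1 / c) * K := by gcongr; exact hK n
    _ = ENNReal.ofReal (1 / c * K) := by
      rw [ENNReal.ofReal_mul (by positivity), ENNReal.ofReal_coe_nnreal]
    _ ≤ ENNReal.ofReal ε := by
      refine ENNReal.ofReal_le_ofReal ?_
      rw [hc, one_div_div, div_mul_eq_mul_div, div_le_iff₀ (by positivity)]
      nlinarith [K.coe_nonneg]

/-- The divergence of two probability measures is bounded by any bound on the divergences of their
images under a sequence of maps that generate an increasing family of σ-algebras exhausting the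
whole one. The densities of the images form a uniformly integrable martingale under `Q`; its
limit is the density of `P`, and Fatou's lemma bounds the divergence. -/
theorem klDiv_le_of_forall_klDiv_map_le {α : Type*} [mα : MeasurableSpace α] {F : ℕ → Type*}
    [mF : ∀ n, MeasurableSpace (F n)] {r : ∀ n, α → F n} (hr : ∀ n, Measurable (r n))
    (hmono : Monotone fun n => (mF n).comap (r n)) (hgen : ⨆ n, (mF n).comap (r n) = mα)
    {P Q : Measure α} [IsProbabilityMeasure P] [IsProbabilityMeasure Q] {K : ℝ≥0∞}
    (hK : ∀ n, klDiv (P.map (r n)) (Q.map (r n)) ≤ K) : klDiv P Q ≤ K := by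
  rcases eq_or_ne K ∞ with rfl | hKtop
  · exact le_top
  lift K to ℝ≥0 using hKtop
  have hPn : ∀ n, IsProbabilityMeasure (P.map (r n)) := fun n =>
    Measure.isProbabilityMeasure_map (hr n).aemeasurable
  have hQn : ∀ n, IsProbabilityMeasure (Q.map (r n)) := fun n =>
    Measure.isProbabilityMeasure_map (hr n).aemeasurable
  have hac : ∀ n, P.map (r n) ≪ Q.map (r n) := fun n =>
    (klDiv_ne_top_iff.1 ((hK n).trans_lt ENNReal.coe_lt_top).ne).1
  let ℱ : Filtration ℕ mα := ⟨fun n => (mF n).comap (r n), hmono, fun n => (hr n).comap_le⟩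
  let φ : ∀ n, F n → ℝ := fun n y => ((P.map (r n)).rnDeriv (Q.map (r n)) y).toReal
  have hφ : ∀ n, Measurable (φ n) := fun n => (Measure.measurable_rnDeriv _ _).ennreal_toReal
  let f : ℕ → α → ℝ := fun n x => φ n (r n x)
  have hfm : ∀ n, Measurable (f n) := fun n => (hφ n).comp (hr n)
  have hf0 : ∀ n x, 0 ≤ f n x := fun n x => ENNReal.toReal_nonneg
  have hfkl : ∀ n, ∫⁻ x, ENNReal.ofReal (klFun (f n x)) ∂Q ≤ K := fun n => by
    refine le_trans (le_of_eq ?_) (hK n)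
    rw [klDiv_eq_lintegral_klFun_of_ac (hac n), lintegral_map (by fun_prop) (hr n)]
  have hUI := uniformIntegrable_of_lintegral_klFun_le hfm hf0 hfkl
  have hfint : ∀ n, Integrable (f n) Q := fun n => memLp_one_iff_integrable.1 (hUI.memLp n)
  -- over an event determined by `r n`, the density `f n` integrates to the `P`-probability
  have hset : ∀ n, ∀ s, MeasurableSet[ℱ n] s → ∫ x in s, f n x ∂Q = P.real s := by
    rintro n _ ⟨t, ht, rfl⟩
    rw [← setIntegral_map ht (hφ n).aestronglyMeasurable (hr n).aemeasurable,
      Measure.setIntegral_toReal_rnDeriv (hac n), map_measureReal_apply (hr n) ht]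
  have hadp : StronglyAdapted ℱ f := fun n =>
    (show Measurable[(mF n).comap (r n)] (f n) from
      (hφ n).comp (comap_measurable (r n))).stronglyMeasurable
  have hmart : Martingale f ℱ Q := martingale_of_setIntegral_eq_succ hadp hfint fun n s hs => by
    rw [hset n s hs, hset (n + 1) s (hmono (Nat.le_succ n) s hs)]
  set g := Filtration.limitProcess f ℱ Q with hg
  obtain ⟨R, hR⟩ := hUI.2.2
  have hlim : ∀ᵐ x ∂Q, Tendsto (fun n => f n x) atTop (𝓝 (g x)) :=
    hmart.submartingale.ae_tendsto_limitProcess hR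
  have hgint : Integrable g Q := memLp_one_iff_integrable.1
    (hmart.submartingale.memLp_limitProcess hR)
  have hg0 : 0 ≤ᵐ[Q] g := by
    filter_upwards [hlim] with x hx using ge_of_tendsto' hx fun n => hf0 n x
  have hgset : ∀ n, ∀ s, MeasurableSet[ℱ n] s → ∫ x in s, g x ∂Q = P.real s := by
    intro n s hs
    rw [← hset n s hs, ← setIntegral_condExp (ℱ.le n) hgint hs]
    refine setIntegral_congr_ae (ℱ.le n s hs) ?_
    filter_upwards [hmart.ae_eq_condExp_limitProcess hUI n] with x hx _ using hx.symm
  -- the limit of the densities is the density of `P`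
  have hPQ : Q.withDensity (fun x => ENNReal.ofReal (g x)) = P := by
    have hfin : IsFiniteMeasure (Q.withDensity fun x => ENNReal.ofReal (g x)) :=
      isFiniteMeasure_withDensity_ofReal hgint.2
    have happ : ∀ n, ∀ s, MeasurableSet[ℱ n] s →
        Q.withDensity (fun x => ENNReal.ofReal (g x)) s = P s := by
      intro n s hs
      rw [withDensity_apply _ (ℱ.le n s hs), ← ofReal_integral_eq_lintegral_ofReal
        hgint.integrableOn (ae_restrict_of_ae hg0), hgset n s hs, ofReal_measureReal]
    refine ext_of_generate_finite (⋃ n, {s | MeasurableSet[ℱ n] s}) ?_ ?_ ?_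
      (happ 0 _ MeasurableSet.univ)
    · exact hgen.symm.trans (MeasurableSpace.generateFrom_iUnion_measurableSet _).symm
    · exact isPiSystem_iUnion_of_monotone _
        (fun n => @MeasurableSpace.isPiSystem_measurableSet _ (ℱ n)) fun _ _ h s hs => hmono h s hs
    · intro s hs
      obtain ⟨n, hn⟩ := Set.mem_iUnion.1 hs
      exact happ n s hn
  have hPac : P ≪ Q := hPQ ▸ withDensity_absolutelyContinuous _ _
  have hrn : P.rnDeriv Q =ᵐ[Q] fun x => ENNReal.ofReal (g x) := by
    conv_lhs => rw [← hPQ]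
    exact Measure.rnDeriv_withDensity₀ _ hgint.1.aemeasurable.ennreal_ofReal
  rw [klDiv_eq_lintegral_klFun_of_ac hPac]
  calc ∫⁻ x, ENNReal.ofReal (klFun (P.rnDeriv Q x).toReal) ∂Q
      = ∫⁻ x, liminf (fun n => ENNReal.ofReal (klFun (f n x))) atTop ∂Q := by
        refine lintegral_congr_ae ?_
        filter_upwards [hrn, hlim, hg0] with x hx hxl hx0
        rw [hx, ENNReal.toReal_ofReal hx0]
        refine (Tendsto.liminf_eq ?_).symm
        exact (ENNReal.continuous_ofReal.comp continuous_klFun).continuousAt.tendsto.comp hxl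
    _ ≤ liminf (fun n => ∫⁻ x, ENNReal.ofReal (klFun (f n x)) ∂Q) atTop :=
        lintegral_liminf_le fun n => (measurable_klFun.comp (hfm n)).ennreal_ofReal
    _ ≤ K := liminf_le_of_frequently_le' (Eventually.of_forall hfkl).frequently

end InformationTheory

/-! ### Conditional mutual information -/

namespace InformationTheory

/-- An injective change of variables with a measurable left inverse preserves the divergence, by the
data processing inequality in both directions. -/
lemma klDiv_map_of_leftInverse {α β : Type*} {mα : MeasurableSpace α} {mβ : MeasurableSpace β}
    {P Q : Measure α} [IsFiniteMeasure P] [IsFiniteMeasure Q] {f : α → β} {g : β → α}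
    (hf : Measurable f) (hg : Measurable g) (hgf : Function.LeftInverse g f) :
    klDiv (P.map f) (Q.map f) = klDiv P Q := by
  refine le_antisymm (klDiv_map_le _ _ hf) ?_
  have h := klDiv_map_le (P.map f) (Q.map f) hg
  rwa [Measure.map_map hg hf, Measure.map_map hg hf, hgf.comp_eq_id, Measure.map_id,
    Measure.map_id] at h

end InformationTheory

namespace ContinualSL

open InformationTheory

variable {Ω α β β' γ δ : Type*} {mΩ : MeasurableSpace Ω} {mα : MeasurableSpace α}
  {mβ : MeasurableSpace β} {mβ' : MeasurableSpace β'} {mγ : MeasurableSpace γ}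
  {mδ : MeasurableSpace δ} {μ : Measure Ω} [IsProbabilityMeasure μ]
  [StandardBorelSpace β] [Nonempty β] [StandardBorelSpace β'] [Nonempty β']
  [StandardBorelSpace γ] [Nonempty γ]
  {B : Ω → β} {B' : Ω → β'} {C : Ω → γ} {D : Ω → δ}

/-- `I(B; C | D)` compares the conditional law of `B` given `(D, C)` with that given `D`, on
average over `(D, C)`. -/
lemma condMutualInfo_eq_klDiv_compProd (hB : Measurable B) (hC : Measurable C) (hD : Measurable D)
    {η : Kernel δ β} [IsMarkovKernel η] (hη : HasCondDistrib B D η μ) :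
    condMutualInfo B C D μ = klDiv (μ.map fun ω => ((D ω, C ω), B ω))
      (μ.map (fun ω => (D ω, C ω)) ⊗ₘ η.prodMkRight γ) := by
  have := Measure.isProbabilityMeasure_map (μ := μ) hD.aemeasurable
  have := Measure.isProbabilityMeasure_map (μ := μ) (hD.prodMk (hB.prodMk hC)).aemeasurable
  have hC' := hasCondDistrib_condDistrib (μ := μ) hC hD
  rw [condMutualInfo, ← klDiv_map_of_leftInverse (f := fun p : δ × β × γ => ((p.1, p.2.2), p.2.1))
    (g := fun p => (p.1.1, p.2, p.1.2)) (by fun_prop) (by fun_prop) (fun _ => rfl)]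
  congr 1
  · rw [Measure.map_map (by fun_prop) (by fun_prop)]
    rfl
  · rw [hC'.map_eq]
    refine Measure.ext_of_lintegral _ fun f hf => ?_
    rw [lintegral_map hf (by fun_prop), Measure.lintegral_compProd (by fun_prop),
      Measure.lintegral_compProd hf, Measure.lintegral_compProd]
    · refine lintegral_congr_ae ?_
      filter_upwards [hη.condDistrib_ae_eq] with d hd
      simp only [Kernel.prodMkRight_apply]
      rw [Kernel.lintegral_prod_symm _ _ _ (by fun_prop), hd]
    · exact Measurable.lintegral_kernel_prod_right' (κ := η.prodMkRight γ) hf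

/-- Conditional independence makes the conditional mutual information vanish. -/
lemma condMutualInfo_eq_zero (hB : Measurable B) (hC : Measurable C) (hD : Measurable D)
    {η : Kernel δ β} [IsMarkovKernel η]
    (h : HasCondDistrib B (fun ω => (D ω, C ω)) (η.prodMkRight γ) μ) :
    condMutualInfo B C D μ = 0 := by
  have hη : HasCondDistrib B D η μ := HasCondDistrib.comp_right (f := Prod.fst) h
  have := Measure.isProbabilityMeasure_map (μ := μ) (hD.prodMk hC).aemeasurable
  rw [condMutualInfo_eq_klDiv_compProd hB hC hD hη, h.map_eq, klDiv_self]

/-- The chain rule `I((B, B'); C | D) = I(B; C | D) + I(B'; C | D, B)`. -/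
lemma condMutualInfo_prodMk_left (hB : Measurable B) (hB' : Measurable B') (hC : Measurable C)
    (hD : Measurable D) :
    condMutualInfo (fun ω => (B ω, B' ω)) C D μ
      = condMutualInfo B C D μ + condMutualInfo B' C (fun ω => (D ω, B ω)) μ := by
  have hη₁ := hasCondDistrib_condDistrib (μ := μ) hB hD
  have hη₂ := hasCondDistrib_condDistrib (μ := μ) hB' (hD.prodMk hB)
  have hκ := hasCondDistrib_condDistrib (μ := μ) hB' ((hD.prodMk hC).prodMk hB)
  set η₁ := condDistrib B D μ
  set η₂ := condDistrib B' (fun ω => (D ω, B ω)) μ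
  set κ := condDistrib B' (fun ω => ((D ω, C ω), B ω)) μ
  let e : (δ × γ) × β → δ × β := fun p => (p.1.1, p.2)
  have he : Measurable e := by fun_prop
  have := Measure.isProbabilityMeasure_map (μ := μ) (hD.prodMk hC).aemeasurable
  have := Measure.isProbabilityMeasure_map (μ := μ) ((hD.prodMk hC).prodMk hB).aemeasurable
  have := Measure.isProbabilityMeasure_map (μ := μ)
    ((hD.prodMk hC).prodMk (hB.prodMk hB')).aemeasurable
  rw [condMutualInfo_eq_klDiv_compProd hB hC hD hη₁,
    condMutualInfo_eq_klDiv_compProd hB' hC (hD.prodMk hB) hη₂,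
    condMutualInfo_eq_klDiv_compProd (hB.prodMk hB') hC hD (hη₁.prodMk_compProd hη₂)]
  calc klDiv (μ.map fun ω => ((D ω, C ω), (B ω, B' ω)))
        (μ.map (fun ω => (D ω, C ω)) ⊗ₘ (η₁ ⊗ₖ η₂).prodMkRight γ)
      = klDiv ((μ.map fun ω => ((D ω, C ω), B ω)) ⊗ₘ κ)
        ((μ.map (fun ω => (D ω, C ω)) ⊗ₘ η₁.prodMkRight γ) ⊗ₘ η₂.comap e he) := by
        rw [← klDiv_map_of_leftInverse
          (f := fun p : (δ × γ) × β × β' => ((p.1, p.2.1), p.2.2))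
          (g := fun p => (p.1.1, p.1.2, p.2)) (by fun_prop) (by fun_prop) (fun _ => rfl),
          ← hκ.map_eq]
        congr 1
        · rw [Measure.map_map (by fun_prop) (by fun_prop)]
          rfl
        · refine Measure.ext_of_lintegral _ fun f hf => ?_
          rw [lintegral_map hf (by fun_prop), Measure.lintegral_compProd (by fun_prop),
            Measure.lintegral_compProd hf, Measure.lintegral_compProd]
          · refine lintegral_congr fun p => ?_
            simp only [Kernel.prodMkRight_apply]
            rw [Kernel.lintegral_compProd _ _ _ (by fun_prop)]
            rfl
          · exact Measurable.lintegral_kernel_prod_right' (κ := η₂.comap e he) hf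
    _ = _ := by
        rw [klDiv_compProd_eq_add]
        congr 1
        rw [← hκ.map_eq, ← klDiv_map_of_leftInverse
          (f := fun p : ((δ × γ) × β) × β' => (((p.1.1.1, p.1.2), p.1.1.2), p.2))
          (g := fun p => (((p.1.1.1, p.1.2), p.1.1.2), p.2)) (by fun_prop) (by fun_prop)
          (fun _ => rfl)]
        · congr 1
          · rw [Measure.map_map (by fun_prop) (by fun_prop)]
            rfl
          · have h2 : μ.map (fun ω => ((D ω, B ω), C ω))
                = (μ.map fun ω => ((D ω, C ω), B ω)).map
                  (fun p => ((p.1.1, p.2), p.1.2)) := by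
              rw [Measure.map_map (by fun_prop) (by fun_prop)]
              rfl
            have hm : Measurable fun p : (δ × γ) × β => ((p.1.1, p.2), p.1.2) := by fun_prop
            rw [h2]
            refine Measure.ext_of_lintegral _ fun f hf => ?_
            rw [lintegral_map hf (by fun_prop), Measure.lintegral_compProd (by fun_prop),
              Measure.lintegral_compProd hf, lintegral_map (μ := Measure.map _ _) _ hm]
            · rfl
            · exact Measurable.lintegral_kernel_prod_right' (κ := η₂.prodMkRight γ) hf

/-- Applying a function to `B` amounts to applying it to both measures in the divergence that
defines the conditional mutual information. -/
lemma condMutualInfo_comp_left (hB : Measurable B) (hC : Measurable C) (hD : Measurable D)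
    {f : β → β'} (hf : Measurable f) :
    condMutualInfo (fun ω => f (B ω)) C D μ
      = klDiv ((μ.map fun ω => ((D ω, C ω), B ω)).map (Prod.map id f))
        ((μ.map (fun ω => (D ω, C ω)) ⊗ₘ (condDistrib B D μ).prodMkRight γ).map
          (Prod.map id f)) := by
  have hη := hasCondDistrib_condDistrib (μ := μ) hB hD
  have := Kernel.IsMarkovKernel.map (condDistrib B D μ) hf
  have h := condMutualInfo_eq_klDiv_compProd (hf.comp hB) hC hD (hη.comp_left hf)
  simp only [Function.comp_def] at h
  rw [h, Measure.map_map (by fun_prop) (by fun_prop), ← Measure.compProd_map hf]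
  congr 2
  rw [Kernel.prodMkRight, Kernel.prodMkRight, Kernel.comap_map_comm]
  exact hf

/-- Applying an injective function to `B` preserves the conditional mutual information. -/
lemma condMutualInfo_comp_left_of_leftInverse (hB : Measurable B) (hC : Measurable C)
    (hD : Measurable D) {f : β → β'} {g : β' → β} (hf : Measurable f) (hg : Measurable g)
    (hgf : Function.LeftInverse g f) :
    condMutualInfo (fun ω => f (B ω)) C D μ = condMutualInfo B C D μ := by
  have := Measure.isProbabilityMeasure_map (μ := μ) (hD.prodMk hC).aemeasurable
  have := Measure.isProbabilityMeasure_map (μ := μ) ((hD.prodMk hC).prodMk hB).aemeasurable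
  rw [condMutualInfo_comp_left hB hC hD hf,
    klDiv_map_of_leftInverse (g := Prod.map id g) (by fun_prop) (by fun_prop)
      (Function.LeftInverse.prodMap (f₁ := id) (f₂ := id) (fun _ => rfl) hgf),
    condMutualInfo_eq_klDiv_compProd hB hC hD (hasCondDistrib_condDistrib hB hD)]

/-- The information about `C` carried by an infinite sequence is the limit of the information
carried by its initial segments. -/
lemma tendsto_condMutualInfo_initialSegment [StandardBorelSpace α] [Nonempty α]
    {Z : Ω → ℕ → α} (hZ : Measurable Z) (hC : Measurable C) (hD : Measurable D) :
    Tendsto (fun n => condMutualInfo (fun ω (i : Fin n) => Z ω i) C D μ) atTop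
      (𝓝 (condMutualInfo Z C D μ)) := by
  let f : ∀ n, (ℕ → α) → (Fin n → α) := fun n z i => z i
  have hf : ∀ n, Measurable (f n) := fun n => by fun_prop
  have := Measure.isProbabilityMeasure_map (μ := μ) (hD.prodMk hC).aemeasurable
  have := Measure.isProbabilityMeasure_map (μ := μ) ((hD.prodMk hC).prodMk hZ).aemeasurable
  have hn : ∀ n, condMutualInfo (fun ω (i : Fin n) => Z ω i) C D μ = _ :=
    fun n => condMutualInfo_comp_left hZ hC hD (hf n)
  have hall := condMutualInfo_eq_klDiv_compProd hZ hC hD (hasCondDistrib_condDistrib (μ := μ) hZ hD)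
  have hmono : Monotone fun n => condMutualInfo (fun ω (i : Fin n) => Z ω i) C D μ := by
    intro m n hmn
    let r : (δ × γ) × (Fin n → α) → (δ × γ) × (Fin m → α) :=
      Prod.map id fun z i => z (Fin.castLE hmn i)
    have hr : Measurable r := by fun_prop
    have hrf : (Prod.map id (f m) : (δ × γ) × (ℕ → α) → _) = r ∘ Prod.map id (f n) := rfl
    simp only [hn]
    rw [hrf, ← Measure.map_map hr (by fun_prop), ← Measure.map_map hr (by fun_prop)]
    exact klDiv_map_le _ _ hr
  have hsup : ⨆ n, condMutualInfo (fun ω (i : Fin n) => Z ω i) C D μ = condMutualInfo Z C D μ := by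
    refine le_antisymm (iSup_le fun n => ?_) ?_
    · rw [hn, hall]
      exact klDiv_map_le _ _ (by fun_prop)
    · rw [hall]
      refine klDiv_le_of_forall_klDiv_map_le
        (r := fun n => (Prod.map id (f n) : (δ × γ) × (ℕ → α) → (δ × γ) × (Fin n → α)))
        (fun n => by fun_prop) ?_ ?_ fun n => ?_
      · intro m n hmn
        have hrf : (Prod.map id (f m) : (δ × γ) × (ℕ → α) → _)
          = (Prod.map id fun (z : Fin n → α) i => z (Fin.castLE hmn i)) ∘ Prod.map id (f n) := rfl
        simp only
        rw [hrf, ← MeasurableSpace.comap_comp]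
        refine MeasurableSpace.comap_mono (Measurable.comap_le ?_)
        fun_prop
      · refine le_antisymm (iSup_le fun n => Measurable.comap_le (by fun_prop)) ?_
        have hm : ∀ n, Measurable[⨆ n, MeasurableSpace.comap
            (Prod.map id (f n) : (δ × γ) × (ℕ → α) → (δ × γ) × (Fin n → α)) inferInstance]
            (Prod.map id (f n) : (δ × γ) × (ℕ → α) → (δ × γ) × (Fin n → α)) := fun n =>
          (comap_measurable _).mono (le_iSup (fun n => MeasurableSpace.comap
            (Prod.map id (f n) : (δ × γ) × (ℕ → α) → (δ × γ) × (Fin n → α)) inferInstance) n) le_rfl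
        have h1 := measurable_fst.comp (hm 0)
        have h2 := @measurable_pi_iff _ _ _ (_) _ _ |>.2 fun i =>
          ((measurable_pi_apply (Fin.last i)).comp measurable_snd).comp (hm (i + 1))
        exact sup_le h1.comap_le h2.comap_le
      · rw [← hn]
        exact le_iSup (fun n => condMutualInfo (fun ω (i : Fin n) => Z ω i) C D μ) n
  exact hsup ▸ tendsto_atTop_iSup hmono

end ContinualSL

/-! ### Entropy of finite random variables -/

namespace InformationTheory

/-- The divergence of two kernels over a common base measure is the average of the divergences of
the fibres. -/
lemma klDiv_compProd_right_eq_lintegral {α β : Type*} {mα : MeasurableSpace α}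
    {mβ : MeasurableSpace β} [MeasurableSpace.CountableOrCountablyGenerated α β] {P : Measure α}
    [IsFiniteMeasure P] {κ η : Kernel α β} [IsMarkovKernel κ] [IsMarkovKernel η]
    (hac : ∀ᵐ a ∂P, κ a ≪ η a) :
    klDiv (P ⊗ₘ κ) (P ⊗ₘ η) = ∫⁻ a, klDiv (κ a) (η a) ∂P
      ∧ AEMeasurable (fun a => klDiv (κ a) (η a)) P := by
  have hm : Measurable fun p : α × β => Kernel.rnDeriv κ η p.1 p.2 :=
    Kernel.measurable_rnDeriv κ η
  have hd : P ⊗ₘ κ = (P ⊗ₘ η).withDensity fun p => Kernel.rnDeriv κ η p.1 p.2 := by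
    ext s hs
    rw [withDensity_apply _ hs, ← lintegral_indicator hs, Measure.compProd_apply hs,
      Measure.lintegral_compProd (hm.indicator hs)]
    refine lintegral_congr_ae ?_
    filter_upwards [hac] with a ha
    have hsa : MeasurableSet (Prod.mk a ⁻¹' s) := measurable_prodMk_left hs
    calc κ a (Prod.mk a ⁻¹' s)
        = ∫⁻ b in Prod.mk a ⁻¹' s, (κ a).rnDeriv (η a) b ∂η a :=
          (Measure.setLIntegral_rnDeriv ha _).symm
      _ = ∫⁻ b in Prod.mk a ⁻¹' s, Kernel.rnDeriv κ η a b ∂η a :=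
          lintegral_congr_ae (ae_restrict_of_ae Kernel.rnDeriv_eq_rnDeriv_measure.symm)
      _ = _ := by
          rw [← lintegral_indicator hsa]
          rfl
  have hrn := Measure.rnDeriv_withDensity (P ⊗ₘ η) hm
  rw [← hd] at hrn
  have hfib : (fun a => klDiv (κ a) (η a)) =ᵐ[P]
      fun a => ∫⁻ b, ENNReal.ofReal (klFun (Kernel.rnDeriv κ η a b).toReal) ∂η a := by
    filter_upwards [hac] with a ha
    rw [klDiv_eq_lintegral_klFun_of_ac ha]
    refine lintegral_congr_ae ?_
    filter_upwards [Kernel.rnDeriv_eq_rnDeriv_measure (κ := κ) (η := η) (a := a)] with b hb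
    rw [hb]
  refine ⟨?_, (Measurable.lintegral_kernel_prod_right'
    (f := fun p => ENNReal.ofReal (klFun (Kernel.rnDeriv κ η p.1 p.2).toReal))
    (by fun_prop)).aemeasurable.congr hfib.symm⟩
  rw [klDiv_eq_lintegral_klFun_of_ac (hd ▸ withDensity_absolutelyContinuous _ _),
    lintegral_congr_ae hfib]
  calc _ = ∫⁻ p, ENNReal.ofReal (klFun (Kernel.rnDeriv κ η p.1 p.2).toReal) ∂(P ⊗ₘ η) := by
        refine lintegral_congr_ae ?_
        filter_upwards [hrn] with p hp using by rw [hp]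
    _ = _ := Measure.lintegral_compProd (by fun_prop)

end InformationTheory

namespace ContinualSL

open InformationTheory

section Entropy

variable {𝒴 : Type*} [Fintype 𝒴] [MeasurableSpace 𝒴]

/-- The Shannon entropy, in nats, of a probability measure on a finite set. -/
noncomputable def entropy (p : Measure 𝒴) : ℝ := ∑ y, Real.negMulLog (p.real {y})

lemma entropy_nonneg (p : Measure 𝒴) [IsProbabilityMeasure p] : 0 ≤ entropy p :=
  Finset.sum_nonneg fun _ _ => Real.negMulLog_nonneg measureReal_nonneg measureReal_le_one

lemma entropy_le_card (p : Measure 𝒴) [IsProbabilityMeasure p] :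
    entropy p ≤ Fintype.card 𝒴 := by
  have h : ∀ y ∈ Finset.univ, Real.negMulLog (p.real {y}) ≤ 1 := fun y _ => by
    have h0 : 0 ≤ p.real {y} := measureReal_nonneg
    have := klFun_nonneg h0
    rw [klFun_apply] at this
    rw [Real.negMulLog]
    linarith [show p.real {y} ≤ 1 from measureReal_le_one]
  calc entropy p ≤ ∑ _y : 𝒴, (1 : ℝ) := Finset.sum_le_sum h
    _ = _ := by simp

variable [MeasurableSingletonClass 𝒴]

/-- On a finite set the divergence is cross entropy minus entropy. The convention `log 0 = 0` is
harmless, since `p` vanishes wherever `q` does. -/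
lemma klDiv_eq_sum_sub_entropy {p q : Measure 𝒴} [IsProbabilityMeasure p]
    [IsProbabilityMeasure q] (hpq : p ≪ q) :
    (klDiv p q).toReal = (∑ y, p.real {y} * -Real.log (q.real {y})) - entropy p
      ∧ klDiv p q ≠ ∞ := by
  refine ⟨?_, klDiv_ne_top hpq Integrable.of_finite⟩
  rw [toReal_klDiv_of_measure_eq hpq (by simp), integral_fintype Integrable.of_finite, entropy,
    ← Finset.sum_sub_distrib]
  refine Finset.sum_congr rfl fun y _ => ?_
  rcases eq_or_ne (p.real {y}) 0 with h0 | h0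
  · simp [h0]
  have hrn : p.real {y} = (p.rnDeriv q y).toReal * q.real {y} := by
    have h := Measure.setLIntegral_rnDeriv hpq {y}
    rw [lintegral_singleton] at h
    rw [measureReal_def, ← h, ENNReal.toReal_mul, measureReal_def]
  have h1 : (p.rnDeriv q y).toReal ≠ 0 := fun h => h0 (by rw [hrn, h, zero_mul])
  have h2 : q.real {y} ≠ 0 := fun h => h0 (by rw [hrn, h, mul_zero])
  have hl : Real.log (p.real {y}) = llr p q y + Real.log (q.real {y}) := by
    rw [hrn, Real.log_mul h1 h2, llr]
  rw [Real.negMulLog, smul_eq_mul, hl]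
  ring

lemma measurable_entropy_kernel {δ : Type*} [MeasurableSpace δ] (κ : Kernel δ 𝒴) :
    Measurable fun d => entropy (κ d) := by
  refine Finset.measurable_sum _ fun y _ => Real.continuous_negMulLog.measurable.comp ?_
  exact (Kernel.measurable_coe κ (measurableSet_singleton y)).ennreal_toReal

lemma integrable_entropy_kernel {Ω δ : Type*} {mΩ : MeasurableSpace Ω} [MeasurableSpace δ]
    {μ : Measure Ω} [IsProbabilityMeasure μ] {D : Ω → δ} (κ : Kernel δ 𝒴)
    [IsMarkovKernel κ] (hD : Measurable D) :
    Integrable (fun ω => entropy (κ (D ω))) μ := by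
  refine Integrable.of_bound
    ((measurable_entropy_kernel κ).comp hD).aestronglyMeasurable (Fintype.card 𝒴)
    (ae_of_all _ fun ω => ?_)
  rw [Real.norm_of_nonneg (entropy_nonneg _)]
  exact entropy_le_card _

end Entropy

section CondEntropy

variable {Ω 𝒴 δ δ' : Type*} {mΩ : MeasurableSpace Ω} [Fintype 𝒴] [MeasurableSpace 𝒴]
  [MeasurableSingletonClass 𝒴] [Nonempty 𝒴] [MeasurableSpace δ] [MeasurableSpace δ']
  {μ : Measure Ω} [IsProbabilityMeasure μ] {Y : Ω → 𝒴} {D : Ω → δ}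

/-- The conditional entropy `H(Y | D)` of a finite random variable: the average entropy of its
conditional law given `D`. -/
noncomputable def condEntropy (Y : Ω → 𝒴) (D : Ω → δ) (μ : Measure Ω) [IsFiniteMeasure μ] : ℝ :=
  ∫ ω, entropy (condDistrib Y D μ (D ω)) ∂μ

lemma condEntropy_nonneg : 0 ≤ condEntropy Y D μ :=
  integral_nonneg fun _ => entropy_nonneg _

lemma condEntropy_eq {κ : Kernel δ 𝒴} [IsMarkovKernel κ] (h : HasCondDistrib Y D κ μ) :
    condEntropy Y D μ = ∫ ω, entropy (κ (D ω)) ∂μ := by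
  refine integral_congr_ae ?_
  filter_upwards [ae_of_ae_map h.aemeasurable_fst h.condDistrib_ae_eq] with ω hω
  simp only [hω]

/-- The conditional entropy depends on the joint law only. -/
lemma condEntropy_congr_law {Y' : Ω → 𝒴} {D' : Ω → δ} (hD : Measurable D) (hD' : Measurable D')
    (hY : Measurable Y) (hY' : Measurable Y')
    (h : μ.map (fun ω => (D ω, Y ω)) = μ.map (fun ω => (D' ω, Y' ω))) :
    condEntropy Y D μ = condEntropy Y' D' μ := by
  have hc : condDistrib Y D μ = condDistrib Y' D' μ := by
    rw [condDistrib, condDistrib]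
    congr 1
  have hfst : μ.map D = μ.map D' := by
    rw [← Measure.fst_map_prodMk hY, h, Measure.fst_map_prodMk hY']
  have hm := (measurable_entropy_kernel (condDistrib Y' D' μ)).stronglyMeasurable
  rw [condEntropy, condEntropy, hc, ← integral_map hD.aemeasurable hm.aestronglyMeasurable, hfst,
    integral_map hD'.aemeasurable hm.aestronglyMeasurable]

/-- Conditionally irrelevant data can be dropped from the condition. -/
lemma condEntropy_eq_of_hasCondDistrib {g : δ → δ'} (hg : Measurable g) {κ : Kernel δ' 𝒴}
    [IsMarkovKernel κ] (h : HasCondDistrib Y D (κ.comap g hg) μ) :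
    condEntropy Y D μ = condEntropy Y (fun ω => g (D ω)) μ := by
  have h' : HasCondDistrib Y (fun ω => g (D ω)) κ μ := HasCondDistrib.comp_right (f := g) h
  rw [condEntropy_eq h, condEntropy_eq h']
  rfl

lemma lintegral_hasCondDistrib {β : Type*} {mβ : MeasurableSpace β} {B : Ω → β}
    {κ : Kernel δ β} [IsSFiniteKernel κ] (hB : Measurable B) (hD : Measurable D)
    (h : HasCondDistrib B D κ μ)
    {F : δ × β → ℝ≥0∞} (hF : Measurable F) :
    ∫⁻ ω, F (D ω, B ω) ∂μ = ∫⁻ ω, ∫⁻ b, F (D ω, b) ∂κ (D ω) ∂μ := by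
  rw [← lintegral_map hF (hD.prodMk hB), h.map_eq, Measure.lintegral_compProd hF,
    lintegral_map hF.lintegral_kernel_prod_right' hD]

/-- Conditional probabilities given finer and given coarser data integrate alike against
a function of the coarser data. -/
lemma lintegral_condDistrib_mul_comp (hY : Measurable Y) (hD : Measurable D) {g : δ → δ'}
    (hg : Measurable g) (y : 𝒴) {φ : δ' → ℝ≥0∞} (hφ : Measurable φ) :
    ∫⁻ ω, condDistrib Y D μ (D ω) {y} * φ (g (D ω)) ∂μ
      = ∫⁻ ω, condDistrib Y (fun ω => g (D ω)) μ (g (D ω)) {y} * φ (g (D ω)) ∂μ := by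
  have hs : MeasurableSet ({y} : Set 𝒴) := measurableSet_singleton y
  have h1 := lintegral_hasCondDistrib (μ := μ) hY hD (hasCondDistrib_condDistrib hY hD)
    (F := fun p => ({y} : Set 𝒴).indicator (fun _ => φ (g p.1)) p.2) (by
      exact Measurable.indicator (hφ.comp (hg.comp measurable_fst)) (measurable_snd hs))
  have h2 := lintegral_hasCondDistrib (μ := μ) hY (hg.comp hD)
    (hasCondDistrib_condDistrib hY (hg.comp hD))
    (F := fun p => ({y} : Set 𝒴).indicator (fun _ => φ p.1) p.2) (by
      exact Measurable.indicator (hφ.comp measurable_fst) (measurable_snd hs))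
  simp only [lintegral_indicator_const hs] at h1 h2
  simp only [mul_comm _ (φ _)]
  exact h1.symm.trans h2

lemma ae_condDistrib_absolutelyContinuous_comp (hY : Measurable Y) (hD : Measurable D)
    {g : δ → δ'} (hg : Measurable g) :
    ∀ᵐ ω ∂μ, condDistrib Y D μ (D ω) ≪ condDistrib Y (fun ω => g (D ω)) μ (g (D ω)) := by
  have hy : ∀ y : 𝒴, ∀ᵐ ω ∂μ, condDistrib Y (fun ω => g (D ω)) μ (g (D ω)) {y} = 0 →
      condDistrib Y D μ (D ω) {y} = 0 := by
    intro y
    let N : Set δ' := {d | condDistrib Y (fun ω => g (D ω)) μ d {y} = 0}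
    have hcoe : Measurable fun d => condDistrib Y (fun ω => g (D ω)) μ d {y} :=
      Kernel.measurable_coe _ (measurableSet_singleton y)
    have hN : MeasurableSet N := hcoe (measurableSet_singleton 0)
    have h := lintegral_condDistrib_mul_comp (μ := μ) hY hD hg y
      (φ := N.indicator 1) (measurable_one.indicator hN)
    have h0 : ∫⁻ ω, condDistrib Y (fun ω => g (D ω)) μ (g (D ω)) {y}
        * N.indicator 1 (g (D ω)) ∂μ = 0 := by
      refine (lintegral_congr fun ω => ?_).trans lintegral_zero
      by_cases hω : g (D ω) ∈ N
      · rw [show condDistrib Y (fun ω => g (D ω)) μ (g (D ω)) {y} = 0 from hω, zero_mul]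
      · rw [Set.indicator_of_notMem hω, mul_zero]
    rw [h0, lintegral_eq_zero_iff] at h
    · filter_upwards [h] with ω hω hz
      have hmem : g (D ω) ∈ N := hz
      simpa [Set.indicator_of_mem hmem] using hω
    · exact ((Kernel.measurable_coe _ (measurableSet_singleton y)).comp hD).mul
        ((measurable_one.indicator hN).comp (hg.comp hD))
  filter_upwards [ae_all_iff.2 hy] with ω hω
  refine Measure.AbsolutelyContinuous.mk fun s _ hs => ?_
  rw [← Set.biUnion_of_singleton s, measure_biUnion_null_iff s.to_countable]
  exact fun y hys => hω y (measure_mono_null (Set.singleton_subset_iff.2 hys) hs)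

/-- Refining the condition lowers the conditional entropy, and the average divergence between the
finer and the coarser conditional laws is the difference. -/
theorem lintegral_klDiv_condDistrib (hY : Measurable Y) (hD : Measurable D) {g : δ → δ'}
    (hg : Measurable g) :
    ∫⁻ ω, klDiv (condDistrib Y D μ (D ω)) (condDistrib Y (fun ω => g (D ω)) μ (g (D ω))) ∂μ
        = ENNReal.ofReal (condEntropy Y (fun ω => g (D ω)) μ - condEntropy Y D μ)
      ∧ condEntropy Y D μ ≤ condEntropy Y (fun ω => g (D ω)) μ := by
  set κ := condDistrib Y D μ
  set η := condDistrib Y (fun ω => g (D ω)) μ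
  have hac := ae_condDistrib_absolutelyContinuous_comp (μ := μ) hY hD hg
  have hκm : ∀ y, Measurable fun ω => κ (D ω) {y} := fun y =>
    (Kernel.measurable_coe _ (measurableSet_singleton y)).comp hD
  have hηm : ∀ y, Measurable fun d => η d {y} := fun y =>
    Kernel.measurable_coe _ (measurableSet_singleton y)
  have hlog : ∀ y d, 0 ≤ -Real.log ((η d).real {y}) := fun y d =>
    neg_nonneg.2 (Real.log_nonpos measureReal_nonneg measureReal_le_one)
  have hlogm : ∀ y, Measurable fun d => -Real.log ((η d).real {y}) := fun y =>
    (hηm y).ennreal_toReal.log.neg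
  let c : Ω → ℝ := fun ω => ∑ y, (κ (D ω)).real {y} * -Real.log ((η (g (D ω))).real {y})
  have hc0 : ∀ ω, 0 ≤ c ω := fun ω =>
    Finset.sum_nonneg fun y _ => mul_nonneg measureReal_nonneg (hlog y _)
  have hcm : Measurable c := Finset.measurable_sum _ fun y _ =>
    (hκm y).ennreal_toReal.mul ((hlogm y).comp (hg.comp hD))
  have hηint : Integrable (fun ω => entropy (η (g (D ω)))) μ :=
    integrable_entropy_kernel η (hg.comp hD)
  have hκint : Integrable (fun ω => entropy (κ (D ω))) μ := integrable_entropy_kernel κ hD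
  -- by the tower property, the average cross entropy is the coarser conditional entropy
  have hcl : ∫⁻ ω, ENNReal.ofReal (c ω) ∂μ
      = ∫⁻ ω, ENNReal.ofReal (entropy (η (g (D ω)))) ∂μ := by
    have hsum : ∀ (p : Measure 𝒴) [IsProbabilityMeasure p] (d : δ'),
        ENNReal.ofReal (∑ y, p.real {y} * -Real.log ((η d).real {y}))
          = ∑ y, p {y} * ENNReal.ofReal (-Real.log ((η d).real {y})) := by
      intro p _ d
      rw [ENNReal.ofReal_sum_of_nonneg fun y _ => mul_nonneg measureReal_nonneg (hlog y _)]
      refine Finset.sum_congr rfl fun y _ => ?_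
      rw [ENNReal.ofReal_mul measureReal_nonneg, ofReal_measureReal]
    have hent : ∀ d, entropy (η d) = ∑ y, (η d).real {y} * -Real.log ((η d).real {y}) :=
      fun d => Finset.sum_congr rfl fun y _ => by rw [Real.negMulLog]; ring
    simp only [c, hent, hsum]
    have hm₁ : ∀ y ∈ Finset.univ, Measurable fun ω =>
        κ (D ω) {y} * ENNReal.ofReal (-Real.log ((η (g (D ω))).real {y})) := fun y _ =>
      (hκm y).mul ((hlogm y).comp (hg.comp hD)).ennreal_ofReal
    have hm₂ : ∀ y ∈ Finset.univ, Measurable fun ω =>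
        η (g (D ω)) {y} * ENNReal.ofReal (-Real.log ((η (g (D ω))).real {y})) := fun y _ =>
      ((hηm y).comp (hg.comp hD)).mul ((hlogm y).comp (hg.comp hD)).ennreal_ofReal
    rw [lintegral_finsetSum _ hm₁, lintegral_finsetSum _ hm₂]
    exact Finset.sum_congr rfl fun y _ =>
      lintegral_condDistrib_mul_comp hY hD hg y (hlogm y).ennreal_ofReal
  have hcint : Integrable c μ := by
    refine ⟨hcm.aestronglyMeasurable, ?_⟩
    rw [hasFiniteIntegral_iff_ofReal (ae_of_all _ hc0), hcl]
    exact (hasFiniteIntegral_iff_ofReal (ae_of_all _ fun _ => entropy_nonneg _)).1 hηint.2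
  have hcI : ∫ ω, c ω ∂μ = condEntropy Y (fun ω => g (D ω)) μ := by
    rw [integral_eq_lintegral_of_nonneg_ae (ae_of_all _ hc0) hcm.aestronglyMeasurable, hcl,
      condEntropy, integral_eq_lintegral_of_nonneg_ae (ae_of_all _ fun _ => entropy_nonneg _)
        hηint.1]
  have hnonneg : 0 ≤ᵐ[μ] fun ω => c ω - entropy (κ (D ω)) := by
    filter_upwards [hac] with ω hω
    exact (klDiv_eq_sum_sub_entropy hω).1 ▸ ENNReal.toReal_nonneg
  have hI : ∫ ω, (c ω - entropy (κ (D ω))) ∂μ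
      = condEntropy Y (fun ω => g (D ω)) μ - condEntropy Y D μ := by
    rw [integral_sub hcint hκint, hcI]
    rfl
  refine ⟨?_, sub_nonneg.1 (hI ▸ integral_nonneg_of_ae hnonneg)⟩
  rw [← hI, ofReal_integral_eq_lintegral_ofReal
    (f := fun ω => c ω - entropy (κ (D ω))) (hcint.sub hκint) hnonneg]
  refine lintegral_congr_ae ?_
  filter_upwards [hac] with ω hω
  rw [← ENNReal.ofReal_toReal (klDiv_eq_sum_sub_entropy hω).2, (klDiv_eq_sum_sub_entropy hω).1]

lemma condEntropy_le_comp (hY : Measurable Y) (hD : Measurable D) {g : δ → δ'}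
    (hg : Measurable g) : condEntropy Y D μ ≤ condEntropy Y (fun ω => g (D ω)) μ :=
  (lintegral_klDiv_condDistrib hY hD hg).2

/-- Conditions that determine each other give the same conditional entropy. -/
lemma condEntropy_congr_of_comp {D' : Ω → δ'} (hY : Measurable Y) (hD : Measurable D)
    (hD' : Measurable D') {f : δ → δ'} (hf : Measurable f) (hfD : ∀ ω, D' ω = f (D ω))
    {g : δ' → δ} (hg : Measurable g) (hgD : ∀ ω, D ω = g (D' ω)) :
    condEntropy Y D μ = condEntropy Y D' μ := by
  refine le_antisymm ?_ ?_
  · rw [funext hfD]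
    exact condEntropy_le_comp hY hD hf
  · rw [funext hgD]
    exact condEntropy_le_comp hY hD' hg

/-- For a finite variable `Y`, `I(Y; C | D) = H(Y | D) - H(Y | D, C)`. -/
theorem condMutualInfo_eq_ofReal {γ : Type*} {mγ : MeasurableSpace γ} [StandardBorelSpace γ]
    [Nonempty γ] {C : Ω → γ} (hY : Measurable Y) (hC : Measurable C) (hD : Measurable D) :
    condMutualInfo Y C D μ
      = ENNReal.ofReal (condEntropy Y D μ - condEntropy Y (fun ω => (D ω, C ω)) μ) := by
  have hDC : Measurable fun ω => (D ω, C ω) := hD.prodMk hC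
  have hκ := hasCondDistrib_condDistrib (μ := μ) hY hDC
  have := Measure.isProbabilityMeasure_map (μ := μ) hDC.aemeasurable
  have hac : ∀ᵐ a ∂(μ.map fun ω => (D ω, C ω)), condDistrib Y (fun ω => (D ω, C ω)) μ a
      ≪ (condDistrib Y D μ).prodMkRight γ a :=
    (ae_map_iff hDC.aemeasurable (Kernel.measurableSet_absolutelyContinuous _ _)).2
      (ae_condDistrib_absolutelyContinuous_comp hY hDC measurable_fst)
  have hkl := klDiv_compProd_right_eq_lintegral hac
  rw [condMutualInfo_eq_klDiv_compProd hY hC hD (hasCondDistrib_condDistrib hY hD), hκ.map_eq,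
    hkl.1, lintegral_map' hkl.2 hDC.aemeasurable]
  exact (lintegral_klDiv_condDistrib hY hDC measurable_fst).1

end CondEntropy

end ContinualSL

/-! ### Histories, stationarity and conditional independence in the model -/

namespace ContinualSL

open InformationTheory

section Segment

variable {Ω α : Type*} [MeasurableSpace Ω] [MeasurableSpace α]

/-- The segment `(Z_s, …, Z_{s+n-1})` of length `n` of a process. -/
def segment (Z : ℕ → Ω → α) (s n : ℕ) (ω : Ω) : Fin n → α := fun i => Z (s + i) ω

lemma measurable_segment {Z : ℕ → Ω → α} (hZ : ∀ t, Measurable (Z t)) (s n : ℕ) :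
    Measurable (segment Z s n) := measurable_pi_lambda _ fun _ => hZ _

omit [MeasurableSpace Ω] [MeasurableSpace α] in
lemma segment_succ (Z : ℕ → Ω → α) (s n : ℕ) (ω : Ω) :
    segment Z s (n + 1) ω = Fin.cons (Z s ω) (segment Z (s + 1) n ω) := by
  funext i
  refine Fin.cases rfl (fun i => ?_) i
  simp only [segment, Fin.cons_succ, Fin.val_succ]
  rw [show s + (i + 1 : ℕ) = s + 1 + i by omega]

lemma measurable_fin_cons (n : ℕ) :
    Measurable fun p : α × (Fin n → α) => (Fin.cons p.1 p.2 : Fin (n + 1) → α) := by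
  refine measurable_pi_iff.2 fun i => ?_
  refine Fin.cases ?_ (fun i => ?_) i
  · simpa using measurable_fst
  · simp only [Fin.cons_succ]
    fun_prop

lemma measurable_fin_snoc (n : ℕ) :
    Measurable fun p : (Fin n → α) × α => (Fin.snoc p.1 p.2 : Fin (n + 1) → α) := by
  refine measurable_pi_iff.2 fun i => ?_
  refine Fin.lastCases ?_ (fun i => ?_) i
  · simpa using measurable_snd
  · simp only [Fin.snoc_castSucc]
    fun_prop

lemma measurable_history {Z : ℕ → Ω → α} (hZ : ∀ t, Measurable (Z t)) (t : ℕ) :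
    Measurable (history Z t) := measurable_pi_lambda _ fun _ => hZ _

/-- The history through time `t + 1` assembled from the history through time `t` and the next
value. -/
def appendHistory (t : ℕ) (p : (Finset.Iic t → α) × α) : Finset.Iic (t + 1) → α := fun i =>
  if h : (i : ℕ) ≤ t then p.1 ⟨i, Finset.mem_Iic.2 h⟩ else p.2

lemma measurable_appendHistory (t : ℕ) : Measurable (appendHistory (α := α) t) := by
  refine measurable_pi_iff.2 fun i => ?_
  by_cases h : (i : ℕ) ≤ t
  · simp only [appendHistory, dif_pos h]
    fun_prop
  · simp only [appendHistory, dif_neg h]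
    fun_prop

omit [MeasurableSpace Ω] [MeasurableSpace α] in
lemma appendHistory_history (Z : ℕ → Ω → α) (t : ℕ) (ω : Ω) :
    appendHistory t (history Z t ω, Z (t + 1) ω) = history Z (t + 1) ω := by
  funext i
  by_cases h : (i : ℕ) ≤ t
  · simp only [appendHistory, dif_pos h]
    rfl
  · simp only [appendHistory, dif_neg h]
    have hi : (i : ℕ) = t + 1 := le_antisymm (Finset.mem_Iic.1 i.2) (by omega)
    simp only [history, block, hi]

end Segment

section Stationary

variable {Ω α 𝒴 δ : Type*} [MeasurableSpace Ω] [MeasurableSpace α] [Fintype 𝒴]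
  [MeasurableSpace 𝒴] [MeasurableSingletonClass 𝒴] [Nonempty 𝒴] [MeasurableSpace δ]
  {μ : Measure Ω} [IsProbabilityMeasure μ]

lemma IsStationary.condEntropy_shift {Z : ℕ → Ω → α} (hZ : ∀ t, Measurable (Z t))
    (h : IsStationary Z μ) {G : (ℕ → α) → 𝒴} (hG : Measurable G) {F : (ℕ → α) → δ}
    (hF : Measurable F) (s : ℕ) :
    condEntropy (fun ω => G fun t => Z (s + t) ω) (fun ω => F fun t => Z (s + t) ω) μ
      = condEntropy (fun ω => G fun t => Z t ω) (fun ω => F fun t => Z t ω) μ := by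
  have hs : Measurable fun ω t => Z (s + t) ω := measurable_pi_lambda _ fun _ => hZ _
  have h0 : Measurable fun ω t => Z t ω := measurable_pi_lambda _ fun _ => hZ _
  refine condEntropy_congr_law (hF.comp hs) (hF.comp h0) (hG.comp hs) (hG.comp h0) ?_
  have := congrArg (fun m => m.map fun z => (F z, G z)) (h s)
  rwa [Measure.map_map (hF.prodMk hG) hs, Measure.map_map (hF.prodMk hG) h0] at this

end Stationary

section Interaction

variable {Ω 𝒳 𝒴 𝒰 : Type*} [MeasurableSpace Ω]
  [MeasurableSpace 𝒳] [MeasurableSpace 𝒴] [Fintype 𝒴] [MeasurableSpace 𝒰]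
  {μ : Measure Ω} [IsProbabilityMeasure μ]
  {ρ : ∀ t : ℕ, Kernel (Finset.Iic t → 𝒴 × 𝒳) (𝒴 × 𝒳)} [∀ t, IsMarkovKernel (ρ t)]
  {π : Kernel 𝒰 (stdSimplex ℝ 𝒴)} {ψ : Kernel (𝒰 × stdSimplex ℝ 𝒴 × (𝒴 × 𝒳)) 𝒰}
  {O : ℕ → Ω → 𝒴 × 𝒳} {A : ℕ → Ω → stdSimplex ℝ 𝒴} {U : ℕ → Ω → 𝒰}

/-- Given the past data, the next observation does not depend on the past states. -/
lemma IsSupervisedInteraction.hasCondDistrib_obs (h : IsSupervisedInteraction μ ρ π ψ O A U)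
    (t : ℕ) : HasCondDistrib (O (t + 1)) (fun ω => (history O t ω, history U t ω))
      ((ρ t).prodMkRight _) μ :=
  (h.obs_law t).of_comp (f := fun p => (p.1, p.2.1)) (by fun_prop) (fun _ => rfl) fun _ => rfl

/-- The law of the next agent state given the current state and the next observation, with the
action averaged out. -/
noncomputable def stateKernel (π : Kernel 𝒰 (stdSimplex ℝ 𝒴))
    (ψ : Kernel (𝒰 × stdSimplex ℝ 𝒴 × (𝒴 × 𝒳)) 𝒰) : Kernel (𝒰 × (𝒴 × 𝒳)) 𝒰 :=
  (π.prodMkRight (𝒴 × 𝒳) ⊗ₖ ψ.comap (fun p => (p.1.1, p.2, p.1.2)) (by fun_prop)).snd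

variable [IsMarkovKernel π] [IsMarkovKernel ψ]

instance : IsMarkovKernel (stateKernel π ψ) := by
  unfold stateKernel; infer_instance

/-- The next agent state depends on the data, past and future, only through the current state and
the next observation. -/
lemma IsSupervisedInteraction.hasCondDistrib_state (h : IsSupervisedInteraction μ ρ π ψ O A U)
    (t : ℕ) : ∀ k : ℕ, HasCondDistrib (U (t + 1)) (fun ω => (history O (t + 1 + k) ω, U t ω))
      ((stateKernel π ψ).comap
        (fun p => (p.2, p.1 ⟨t + 1, Finset.mem_Iic.2 (Nat.le_add_right _ _)⟩)) (by fun_prop)) μ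
  | 0 => by
    have hA : HasCondDistrib (A t) (fun ω => (history O t ω, U t ω))
        (π.comap Prod.snd measurable_snd) μ :=
      (h.action_law t).of_comp (f := fun p => (p.1, p.2.1 ⟨t, Finset.mem_Iic.2 le_rfl⟩))
        (by fun_prop) (fun _ => rfl) fun _ => rfl
    have hO : HasCondDistrib (O (t + 1)) (fun ω => ((history O t ω, U t ω), A t ω))
        (((ρ t).prodMkRight 𝒰).prodMkRight (stdSimplex ℝ 𝒴)) μ :=
      (h.obs_law t).of_comp (f := fun p => ((p.1, p.2.1 ⟨t, Finset.mem_Iic.2 le_rfl⟩),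
          p.2.2 ⟨t, Finset.mem_Iic.2 le_rfl⟩)) (by fun_prop) (fun _ => rfl) fun _ => rfl
    -- the action is still drawn from `π (U t)` once the next observation is known
    have hA' : HasCondDistrib (A t) (fun ω => (history O (t + 1) ω, U t ω))
        (π.comap Prod.snd measurable_snd) μ :=
      (hA.swap hO).of_comp (f := fun p => (appendHistory t (p.1.1, p.2), p.1.2))
        (((measurable_appendHistory t).comp (by fun_prop)).prodMk (by fun_prop)) (fun _ => rfl)
        fun ω => by rw [appendHistory_history]
    have hU : HasCondDistrib (U (t + 1)) (fun ω => ((history O (t + 1) ω, U t ω), A t ω))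
        (ψ.comap (fun p => (p.1.2, p.2, p.1.1 ⟨t + 1, Finset.mem_Iic.2 le_rfl⟩))
          (by fun_prop)) μ :=
      (h.state_law t).of_comp (f := fun p => ((p.1, p.2.1 ⟨t, Finset.mem_Iic.2 le_rfl⟩),
          p.2.2 ⟨t, Finset.mem_Iic.2 le_rfl⟩)) (by fun_prop) (fun _ => rfl) fun _ => rfl
    refine (hA'.prodMk_compProd hU).snd.of_comp (f := id) measurable_id (fun d => ?_)
      fun ω => rfl
    ext s hs
    rw [Kernel.comap_apply, stateKernel, Kernel.snd_apply' _ _ hs, Kernel.snd_apply' _ _ hs,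
      Kernel.compProd_apply (measurable_snd hs), Kernel.compProd_apply (measurable_snd hs)]
    rfl
  | k + 1 => by
    have hU := IsSupervisedInteraction.hasCondDistrib_state h t k
    have hO : HasCondDistrib (O (t + 1 + k + 1))
        (fun ω => ((history O (t + 1 + k) ω, U t ω), U (t + 1) ω))
        (((ρ (t + 1 + k)).prodMkRight 𝒰).prodMkRight 𝒰) μ :=
      (h.hasCondDistrib_obs (t + 1 + k)).of_comp
        (f := fun p => ((p.1, p.2 ⟨t, Finset.mem_Iic.2 (by omega)⟩),
          p.2 ⟨t + 1, Finset.mem_Iic.2 (by omega)⟩)) (by fun_prop) (fun _ => rfl) fun _ => rfl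
    refine (hU.swap hO).of_comp
      (f := fun p => (appendHistory (t + 1 + k) (p.1.1, p.2), p.1.2))
      (((measurable_appendHistory _).comp (by fun_prop)).prodMk (by fun_prop)) (fun d => ?_)
      fun ω => by rw [appendHistory_history]; rfl
    simp only [Kernel.prodMkRight_apply, Kernel.comap_apply, appendHistory]
    rw [dif_pos (Nat.le_add_right _ _)]

end Interaction

end ContinualSL

/-! ### Entropies of labels and the informational error -/

namespace ContinualSL

open InformationTheory

section Horizon

variable {Ω 𝒳 𝒴 𝒰 : Type*} [MeasurableSpace Ω]
  [MeasurableSpace 𝒳] [StandardBorelSpace 𝒳] [Nonempty 𝒳]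
  [MeasurableSpace 𝒴] [MeasurableSingletonClass 𝒴] [Fintype 𝒴] [Nonempty 𝒴]
  [MeasurableSpace 𝒰]
  {μ : Measure Ω} [IsProbabilityMeasure μ]
  {ρ : ∀ t : ℕ, Kernel (Finset.Iic t → 𝒴 × 𝒳) (𝒴 × 𝒳)} [∀ t, IsMarkovKernel (ρ t)]
  {π : Kernel 𝒰 (stdSimplex ℝ 𝒴)} {ψ : Kernel (𝒰 × stdSimplex ℝ 𝒴 × (𝒴 × 𝒳)) 𝒰}
  {O : ℕ → Ω → 𝒴 × 𝒳} {A : ℕ → Ω → stdSimplex ℝ 𝒴} {U : ℕ → Ω → 𝒰}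

/-- An input that is independent of the earlier data and of its simultaneous label is independent of
these jointly with the earlier agent states. -/
lemma IsSupervisedInteraction.hasCondDistrib_input (h : IsSupervisedInteraction μ ρ π ψ O A U)
    {t : ℕ} (hX : IndepFun (fun ω => (O (t + 1) ω).2)
      (fun ω => (history O t ω, (O (t + 1) ω).1)) μ) :
    HasCondDistrib (fun ω => (O (t + 1) ω).2)
      (fun ω => ((history O t ω, history U t ω), (O (t + 1) ω).1))
      (Kernel.const _ (μ.map fun ω => (O (t + 1) ω).2)) μ := by
  have hOm := h.measurable_obs (t + 1)
  have hYm : Measurable fun ω => (O (t + 1) ω).1 := hOm.fst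
  have hXm : Measurable fun ω => (O (t + 1) ω).2 := hOm.snd
  have hH := measurable_history h.measurable_obs t
  have hU := measurable_history h.measurable_state t
  have := Measure.isProbabilityMeasure_map (μ := μ) hXm.aemeasurable
  set P := μ.map fun ω => (O (t + 1) ω).2
  set η := condDistrib (fun ω => (O (t + 1) ω).1) (history O t) μ
  -- given the data, the next observation has the product law `η × P`
  have hprod : HasCondDistrib (O (t + 1)) (history O t) (η ⊗ₖ Kernel.const _ P) μ :=
    (hasCondDistrib_condDistrib hYm hH).prodMk_compProd
      (hasCondDistrib_const_of_indepFun hXm (hH.prodMk hYm) hX)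
  have hρ : HasCondDistrib (O (t + 1)) (history O t) (ρ t) μ :=
    (h.hasCondDistrib_obs t).of_comp measurable_fst (fun _ => rfl) fun _ => rfl
  have hae : ρ t =ᵐ[μ.map (history O t)] η ⊗ₖ Kernel.const _ P :=
    hρ.condDistrib_ae_eq.symm.trans hprod.condDistrib_ae_eq
  have hae' : (ρ t).prodMkRight (Finset.Iic t → 𝒰)
      =ᵐ[μ.map fun ω => (history O t ω, history U t ω)]
        η.prodMkRight (Finset.Iic t → 𝒰) ⊗ₖ Kernel.const _ P := by
    have hfst : μ.map (history O t)
        = (μ.map fun ω => (history O t ω, history U t ω)).map Prod.fst := by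
      rw [Measure.map_map measurable_fst (hH.prodMk hU)]
      rfl
    rw [hfst] at hae
    filter_upwards [ae_of_ae_map measurable_fst.aemeasurable hae] with p hp
    rw [Kernel.prodMkRight_apply, hp]
    ext s hs
    rw [Kernel.compProd_apply hs, Kernel.compProd_apply hs]
    rfl
  exact HasCondDistrib.of_compProd ((h.hasCondDistrib_obs t).congr_kernel hae')

/-- Over a finite horizon, the information about `C` carried by the observations after time `m` is
the sum of the entropy reductions of the successive labels. The inputs contribute nothing. Both `C`
and the condition `D` are functions of the observations and states through time `m`. -/
lemma IsSupervisedInteraction.condMutualInfo_segment (h : IsSupervisedInteraction μ ρ π ψ O A U)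
    (hX : ∀ t : ℕ, IndepFun (fun ω => (O (t + 1) ω).2)
      (fun ω => (history O t ω, (O (t + 1) ω).1)) μ)
    {γ δ : Type*} [MeasurableSpace γ] [StandardBorelSpace γ] [Nonempty γ] [MeasurableSpace δ]
    (m : ℕ) {c : (Finset.Iic m → 𝒴 × 𝒳) × (Finset.Iic m → 𝒰) → γ} (hc : Measurable c)
    {d : (Finset.Iic m → 𝒴 × 𝒳) × (Finset.Iic m → 𝒰) → δ} (hd : Measurable d)
    {C : Ω → γ} (hC : ∀ ω, C ω = c (history O m ω, history U m ω))
    {D : Ω → δ} (hD : ∀ ω, D ω = d (history O m ω, history U m ω)) (n : ℕ) :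
    condMutualInfo (segment O (m + 1) n) C D μ
      = ∑ j ∈ Finset.range n, ENNReal.ofReal
        (condEntropy (fun ω => (O (m + 1 + j) ω).1) (fun ω => (D ω, segment O (m + 1) j ω)) μ
          - condEntropy (fun ω => (O (m + 1 + j) ω).1)
            (fun ω => ((D ω, segment O (m + 1) j ω), C ω)) μ) := by
  have hHU : Measurable fun ω => (history O m ω, history U m ω) :=
    (measurable_history h.measurable_obs m).prodMk (measurable_history h.measurable_state m)
  have hCm : Measurable C := (funext hC : C = _) ▸ hc.comp hHU
  have hDm : Measurable D := (funext hD : D = _) ▸ hd.comp hHU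
  have hS := measurable_segment h.measurable_obs (m + 1)
  induction n with
  | zero =>
    rw [Finset.sum_range_zero]
    obtain ⟨b⟩ : Nonempty (Fin 0 → 𝒴 × 𝒳) := inferInstance
    exact condMutualInfo_eq_zero (hS 0) hCm hDm (η := Kernel.const _ (Measure.dirac b))
      (hasCondDistrib_of_subsingleton b (hDm.prodMk hCm))
  | succ n ih =>
    have hYm : Measurable fun ω => (O (m + 1 + n) ω).1 := (h.measurable_obs _).fst
    have hXm : Measurable fun ω => (O (m + 1 + n) ω).2 := (h.measurable_obs _).snd
    have hsplit : condMutualInfo (fun ω => (segment O (m + 1) n ω, O (m + 1 + n) ω)) C D μ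
        = condMutualInfo (segment O (m + 1) (n + 1)) C D μ :=
      condMutualInfo_comp_left_of_leftInverse
        (f := fun z : Fin (n + 1) → 𝒴 × 𝒳 => (fun i : Fin n => z i.castSucc, z (Fin.last n)))
        (g := fun p => (Fin.snoc p.1 p.2 : Fin (n + 1) → 𝒴 × 𝒳)) (hS (n + 1)) hCm hDm
        (by fun_prop) (measurable_fin_snoc n) fun z => Fin.snoc_init_self z
    have hinput : condMutualInfo (fun ω => (O (m + 1 + n) ω).2) C
        (fun ω => ((D ω, segment O (m + 1) n ω), (O (m + 1 + n) ω).1)) μ = 0 := by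
      have := Measure.isProbabilityMeasure_map (μ := μ) hXm.aemeasurable
      have hidx : m + 1 + n = m + n + 1 := by omega
      refine condMutualInfo_eq_zero hXm hCm ((hDm.prodMk (hS n)).prodMk hYm)
        (η := Kernel.const _ (μ.map fun ω => (O (m + 1 + n) ω).2)) ?_
      have hin := h.hasCondDistrib_input (hX (m + n))
      rw [← hidx] at hin
      -- `r` cuts the histories through time `m + n` down to those through time `m`
      let r : (Finset.Iic (m + n) → 𝒴 × 𝒳) × (Finset.Iic (m + n) → 𝒰) →
          (Finset.Iic m → 𝒴 × 𝒳) × (Finset.Iic m → 𝒰) := fun p =>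
        (fun i => p.1 ⟨i, Finset.mem_Iic.2 ((Finset.mem_Iic.1 i.2).trans (Nat.le_add_right _ _))⟩,
          fun i => p.2 ⟨i, Finset.mem_Iic.2 ((Finset.mem_Iic.1 i.2).trans (Nat.le_add_right _ _))⟩)
      have hr : Measurable r := by fun_prop
      refine hin.of_comp (f := fun p => (((d (r p.1), fun i : Fin n =>
        p.1.1 ⟨m + 1 + i, Finset.mem_Iic.2 (by omega)⟩), p.2), c (r p.1))) (by fun_prop)
        (fun _ => rfl) fun ω => ?_
      rw [hC, hD]
      rfl
    rw [Finset.sum_range_succ, ← ih, ← hsplit,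
      condMutualInfo_prodMk_left (hS n) (h.measurable_obs _) hCm hDm]
    congr 1
    calc condMutualInfo (O (m + 1 + n)) C (fun ω => (D ω, segment O (m + 1) n ω)) μ
        = condMutualInfo (fun ω => ((O (m + 1 + n) ω).1, (O (m + 1 + n) ω).2)) C
          (fun ω => (D ω, segment O (m + 1) n ω)) μ := rfl
      _ = _ := by
        rw [condMutualInfo_prodMk_left hYm hXm hCm (hDm.prodMk (hS n)), hinput, add_zero,
          condMutualInfo_eq_ofReal hYm hCm (hDm.prodMk (hS n))]

end Horizon

section Limits

variable {Ω 𝒳 𝒴 𝒰 : Type*} [MeasurableSpace Ω]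
  [MeasurableSpace 𝒳]
  [MeasurableSpace 𝒴] [MeasurableSingletonClass 𝒴] [Fintype 𝒴] [Nonempty 𝒴]
  [MeasurableSpace 𝒰]
  {μ : Measure Ω} [IsProbabilityMeasure μ]
  {ρ : ∀ t : ℕ, Kernel (Finset.Iic t → 𝒴 × 𝒳) (𝒴 × 𝒳)} [∀ t, IsMarkovKernel (ρ t)]
  {π : Kernel 𝒰 (stdSimplex ℝ 𝒴)} {ψ : Kernel (𝒰 × stdSimplex ℝ 𝒴 × (𝒴 × 𝒳)) 𝒰}
  {O : ℕ → Ω → 𝒴 × 𝒳} {A : ℕ → Ω → stdSimplex ℝ 𝒴} {U : ℕ → Ω → 𝒰}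

/-- The entropy of the label at time `s + n` given the `n` observations before it. -/
noncomputable def dataEntropy (O : ℕ → Ω → 𝒴 × 𝒳) (μ : Measure Ω) [IsFiniteMeasure μ]
    (s n : ℕ) : ℝ :=
  condEntropy (fun ω => (O (s + n) ω).1) (segment O s n) μ

/-- The entropy of the label at time `t + 1 + n` given the `n` observations before it and the agent
state before those. -/
noncomputable def stateEntropy (O : ℕ → Ω → 𝒴 × 𝒳) (U : ℕ → Ω → 𝒰) (μ : Measure Ω)
    [IsFiniteMeasure μ] (t n : ℕ) : ℝ :=
  condEntropy (fun ω => (O (t + 1 + n) ω).1) (fun ω => (U t ω, segment O (t + 1) n ω)) μ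

omit [MeasurableSpace Ω] in
lemma segment_eq {α : Type*} (Z : ℕ → Ω → α) (s n : ℕ) :
    segment Z s n = fun ω (i : Fin n) => Z (s + i) ω := rfl

lemma dataEntropy_eq (hO : ∀ t, Measurable (O t)) (hU : ∀ t, Measurable (U t))
    (hstat : IsStationary (fun t ω => (U t ω, O t ω)) μ) (s n : ℕ) :
    dataEntropy O μ s n = dataEntropy O μ 0 n := by
  have := hstat.condEntropy_shift (fun t => (hU t).prodMk (hO t))
    (G := fun z => (z n).2.1) (by fun_prop) (F := fun z (i : Fin n) => (z i).2) (by fun_prop) s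
  simpa only [dataEntropy, segment_eq, zero_add] using this

lemma stateEntropy_eq (hO : ∀ t, Measurable (O t)) (hU : ∀ t, Measurable (U t))
    (hstat : IsStationary (fun t ω => (U t ω, O t ω)) μ) (t n : ℕ) :
    stateEntropy O U μ t n = stateEntropy O U μ 0 n := by
  have := hstat.condEntropy_shift (fun t => (hU t).prodMk (hO t))
    (G := fun z => (z (1 + n)).2.1) (by fun_prop)
    (F := fun z => ((z 0).1, fun i : Fin n => (z (1 + i)).2)) (by fun_prop) t
  simpa only [stateEntropy, segment_eq, zero_add, add_assoc, add_zero] using this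

lemma dataEntropy_antitone (hO : ∀ t, Measurable (O t)) (hU : ∀ t, Measurable (U t))
    (hstat : IsStationary (fun t ω => (U t ω, O t ω)) μ) : Antitone (dataEntropy O μ 0) := by
  refine antitone_nat_of_succ_le fun n => ?_
  rw [← dataEntropy_eq hO hU hstat 1 n, dataEntropy, dataEntropy,
    show 0 + (n + 1) = 1 + n by omega]
  have hseg : segment O 1 n = fun ω => Fin.tail (segment O 0 (n + 1) ω) := by
    funext ω
    rw [segment_succ, Fin.tail_cons]
  rw [hseg]
  refine condEntropy_le_comp (hO _).fst (measurable_segment hO 0 (n + 1))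
    (g := fun z : Fin (n + 1) → 𝒴 × 𝒳 => Fin.tail z) ?_
  unfold Fin.tail
  fun_prop

lemma stateEntropy_le_dataEntropy (hO : ∀ t, Measurable (O t)) (hU : ∀ t, Measurable (U t))
    (hstat : IsStationary (fun t ω => (U t ω, O t ω)) μ) (n : ℕ) :
    stateEntropy O U μ 0 n ≤ dataEntropy O μ 0 n := by
  rw [← dataEntropy_eq hO hU hstat 1 n, stateEntropy, dataEntropy]
  simp only [zero_add]
  exact condEntropy_le_comp (hO _).fst ((hU 0).prodMk (measurable_segment hO 1 n))
    (g := Prod.snd) measurable_snd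

/-- Given the data, an agent state carries no further information about the next label. -/
lemma IsSupervisedInteraction.condEntropy_history_state
    (h : IsSupervisedInteraction μ ρ π ψ O A U) {i n : ℕ} (hi : i ≤ n) :
    condEntropy (fun ω => (O (n + 1) ω).1) (fun ω => (history O n ω, U i ω)) μ
      = condEntropy (fun ω => (O (n + 1) ω).1) (history O n) μ := by
  have hobs : HasCondDistrib (O (n + 1)) (fun ω => (history O n ω, U i ω))
      ((ρ n).prodMkRight 𝒰) μ :=
    (h.hasCondDistrib_obs n).of_comp (f := fun p => (p.1, p.2 ⟨i, Finset.mem_Iic.2 hi⟩))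
      (by fun_prop) (fun _ => rfl) fun _ => rfl
  refine condEntropy_eq_of_hasCondDistrib (g := Prod.fst) measurable_fst (κ := (ρ n).fst) ?_
  exact hobs.fst

lemma condEntropy_history_eq_dataEntropy (hO : ∀ t, Measurable (O t)) (n : ℕ) :
    condEntropy (fun ω => (O (n + 1) ω).1) (history O n) μ = dataEntropy O μ 0 (n + 1) := by
  rw [dataEntropy, zero_add]
  refine condEntropy_congr_of_comp (hO _).fst (measurable_history hO n)
    (measurable_segment hO 0 (n + 1))
    (f := fun z (i : Fin (n + 1)) => z ⟨i, Finset.mem_Iic.2 (Nat.le_of_lt_succ i.2)⟩)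
    (by fun_prop) (fun ω => ?_)
    (g := fun z (i : Finset.Iic n) => z ⟨i, Nat.lt_succ_of_le (Finset.mem_Iic.1 i.2)⟩)
    (by fun_prop) fun ω => ?_
  · funext i
    simp only [segment, zero_add, history, block]
  · funext i
    simp only [segment, zero_add, history, block]

/-- An agent state is worth no more than the data it was computed from. -/
lemma IsSupervisedInteraction.dataEntropy_le_stateEntropy
    (h : IsSupervisedInteraction μ ρ π ψ O A U) (n : ℕ) :
    dataEntropy O μ 0 (n + 1) ≤ stateEntropy O U μ 0 n := by
  have hO := h.measurable_obs
  rw [← condEntropy_history_eq_dataEntropy hO, ← h.condEntropy_history_state (Nat.zero_le n),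
    stateEntropy, show 0 + 1 + n = n + 1 by omega, zero_add]
  exact condEntropy_le_comp (hO _).fst ((measurable_history hO n).prodMk (h.measurable_state 0))
    (g := fun p => (p.2, fun i : Fin n => p.1 ⟨1 + i, Finset.mem_Iic.2 (by omega)⟩))
    (by fun_prop)

/-- The informational error is the entropy that the agent state leaves in the next label beyond that
left by the data. -/
lemma IsSupervisedInteraction.informationalError_eq
    (h : IsSupervisedInteraction μ ρ π ψ O A U) (t : ℕ) :
    informationalError O U μ t
      = ENNReal.ofReal (stateEntropy O U μ t 0 - dataEntropy O μ 0 (t + 1)) := by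
  have hO := h.measurable_obs
  have hU := h.measurable_state t
  have hH := measurable_history hO t
  have hY : Measurable fun ω => (O (t + 1) ω).1 := (hO _).fst
  have hstate : stateEntropy O U μ t 0 = condEntropy (fun ω => (O (t + 1) ω).1) (U t) μ :=
    condEntropy_congr_of_comp (D := fun ω => (U t ω, segment O (t + 1) 0 ω)) hY
      (hU.prodMk (measurable_segment hO _ _)) hU
      measurable_fst (fun _ => rfl) (g := fun u => (u, Fin.elim0)) (by fun_prop)
      fun ω => Prod.ext rfl (Subsingleton.elim _ _)
  have hobs : HasCondDistrib (O (t + 1)) (fun ω => (history O t ω, U t ω))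
      ((ρ t).prodMkRight 𝒰) μ :=
    (h.hasCondDistrib_obs t).of_comp (f := fun p => (p.1, p.2 ⟨t, Finset.mem_Iic.2 le_rfl⟩))
      (by fun_prop) (fun _ => rfl) fun _ => rfl
  have hobs' : HasCondDistrib (O (t + 1)) (history O t) (ρ t) μ :=
    hobs.of_comp measurable_fst (fun _ => rfl) fun _ => rfl
  have hκ := ae_of_ae_map (hH.prodMk hU).aemeasurable hobs.fst.condDistrib_ae_eq
  have hκ' := ae_of_ae_map hH.aemeasurable hobs'.fst.condDistrib_ae_eq
  rw [hstate, ← condEntropy_history_eq_dataEntropy hO, ← h.condEntropy_history_state le_rfl,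
    ← (lintegral_klDiv_condDistrib hY (hH.prodMk hU) measurable_snd).1, informationalError]
  refine lintegral_congr_ae ?_
  filter_upwards [hκ, hκ'] with ω hω hω'
  rw [hω, hω', Kernel.fst_apply, Kernel.fst_apply, Kernel.prodMkRight_apply]

end Limits

end ContinualSL

/-! ### Telescoping of forgetting and implasticity -/

namespace ContinualSL

section Telescoping

variable {Ω 𝒳 𝒴 𝒰 : Type*} [MeasurableSpace Ω]
  [MeasurableSpace 𝒳] [StandardBorelSpace 𝒳] [Nonempty 𝒳]
  [MeasurableSpace 𝒴] [MeasurableSingletonClass 𝒴] [Fintype 𝒴] [Nonempty 𝒴]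
  [MeasurableSpace 𝒰] [StandardBorelSpace 𝒰] [Nonempty 𝒰]
  {μ : Measure Ω} [IsProbabilityMeasure μ]
  {ρ : ∀ t : ℕ, Kernel (Finset.Iic t → 𝒴 × 𝒳) (𝒴 × 𝒳)} [∀ t, IsMarkovKernel (ρ t)]
  {π : Kernel 𝒰 (stdSimplex ℝ 𝒴)} [IsMarkovKernel π]
  {ψ : Kernel (𝒰 × stdSimplex ℝ 𝒴 × (𝒴 × 𝒳)) 𝒰} [IsMarkovKernel ψ]
  {O : ℕ → Ω → 𝒴 × 𝒳} {A : ℕ → Ω → stdSimplex ℝ 𝒴} {U : ℕ → Ω → 𝒰}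

omit [StandardBorelSpace 𝒳] [Nonempty 𝒳] [StandardBorelSpace 𝒰] [Nonempty 𝒰] in
/-- Given the state at time `t` and the observations after it, the state at time `t + 1` is
irrelevant to later labels: it is generated from those data by independent randomization. -/
lemma IsSupervisedInteraction.condEntropy_update (h : IsSupervisedInteraction μ ρ π ψ O A U)
    (t n : ℕ) :
    condEntropy (fun ω => (O (t + 1 + 1 + n) ω).1)
      (fun ω => (((U (t + 1) ω, O (t + 1) ω), segment O (t + 1 + 1) n ω), U t ω)) μ
      = stateEntropy O U μ t (n + 1) := by
  have hO := h.measurable_obs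
  have hU := h.measurable_state
  have hY : Measurable fun ω => (O (t + 1 + (n + 1)) ω).1 := (hO _).fst
  have hS := measurable_segment hO (t + 1) (n + 1)
  have hD : Measurable fun ω => (U t ω, segment O (t + 1) (n + 1) ω) := (hU t).prodMk hS
  have hη := hasCondDistrib_condDistrib (μ := μ) hY hD
  have hstate : HasCondDistrib (U (t + 1))
      (fun ω => ((U t ω, segment O (t + 1) (n + 1) ω), (O (t + 1 + (n + 1)) ω).1))
      (((stateKernel π ψ).comap (fun p : 𝒰 × (Fin (n + 1) → 𝒴 × 𝒳) => (p.1, p.2 0))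
        (by fun_prop)).prodMkRight 𝒴) μ :=
    (h.hasCondDistrib_state t (n + 1)).of_comp
      (f := fun p => ((p.2, fun i : Fin (n + 1) => p.1 ⟨t + 1 + i, Finset.mem_Iic.2 (by omega)⟩),
        (p.1 ⟨t + 1 + (n + 1), Finset.mem_Iic.2 le_rfl⟩).1)) (by fun_prop) (fun _ => rfl)
      fun _ => rfl
  have hdrop := condEntropy_eq_of_hasCondDistrib (g := Prod.fst) measurable_fst (hη.swap hstate)
  refine Eq.trans ?_ hdrop
  rw [show t + 1 + 1 + n = t + 1 + (n + 1) by omega]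
  have hf : Measurable fun p : ((𝒰 × (𝒴 × 𝒳)) × (Fin n → 𝒴 × 𝒳)) × 𝒰 =>
      ((p.2, (Fin.cons p.1.1.2 p.1.2 : Fin (n + 1) → 𝒴 × 𝒳)), p.1.1.1) :=
    (measurable_snd.prodMk ((measurable_fin_cons n).comp
      (show Measurable fun p : ((𝒰 × (𝒴 × 𝒳)) × (Fin n → 𝒴 × 𝒳)) × 𝒰 => (p.1.1.2, p.1.2)
        by fun_prop))).prodMk (by fun_prop)
  refine condEntropy_congr_of_comp hY ((((hU _).prodMk (hO _)).prodMk
      (measurable_segment hO _ n)).prodMk (hU t)) (hD.prodMk (hU (t + 1))) hf (fun ω => ?_)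
    (g := fun p => (((p.2, p.1.2 0), fun i : Fin n => p.1.2 i.succ), p.1.1)) (by fun_prop)
    fun ω => ?_
  · rw [segment_succ]
  · simp only [segment_succ, Fin.cons_zero, Fin.cons_succ]

/-- At every finite horizon the forgetting and the implasticity terms add up to a telescoping sum of
entropies of labels given an agent state and ever more observations after it. -/
lemma IsSupervisedInteraction.condMutualInfo_add_condMutualInfo
    (h : IsSupervisedInteraction μ ρ π ψ O A U)
    (hstat : IsStationary (fun t ω => (U t ω, O t ω)) μ)
    (hX : ∀ t : ℕ, IndepFun (fun ω => (O (t + 1) ω).2)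
      (fun ω => (history O t ω, (O (t + 1) ω).1)) μ) (t n : ℕ) :
    condMutualInfo (segment O (t + 2) n) (U t) (fun ω => (U (t + 1) ω, O (t + 1) ω)) μ
      + condMutualInfo (segment O (t + 2) n) (O (t + 1)) (U (t + 1)) μ
      = ENNReal.ofReal (stateEntropy O U μ 0 0 - stateEntropy O U μ 0 n) := by
  have hO := h.measurable_obs
  have hU := h.measurable_state
  have hY : ∀ j, Measurable fun ω => (O (t + 1 + 1 + j) ω).1 := fun j => (hO _).fst
  have hS := measurable_segment hO (t + 1 + 1)
  have hF := h.condMutualInfo_segment hX (t + 1)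
    (c := fun p => p.2 ⟨t, Finset.mem_Iic.2 (Nat.le_succ t)⟩) (by fun_prop)
    (d := fun p => (p.2 ⟨t + 1, Finset.mem_Iic.2 le_rfl⟩, p.1 ⟨t + 1, Finset.mem_Iic.2 le_rfl⟩))
    (by fun_prop) (C := U t) (fun _ => rfl) (D := fun ω => (U (t + 1) ω, O (t + 1) ω))
    (fun _ => rfl) n
  have hI := h.condMutualInfo_segment hX (t + 1)
    (c := fun p => p.1 ⟨t + 1, Finset.mem_Iic.2 le_rfl⟩) (by fun_prop)
    (d := fun p => p.2 ⟨t + 1, Finset.mem_Iic.2 le_rfl⟩)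
    (by fun_prop) (C := O (t + 1)) (fun _ => rfl) (D := U (t + 1)) (fun _ => rfl) n
  -- the entropy left by the new state and observation separates the two contributions
  let a : ℕ → ℝ := fun j => condEntropy (fun ω => (O (t + 1 + 1 + j) ω).1)
    (fun ω => ((U (t + 1) ω, O (t + 1) ω), segment O (t + 1 + 1) j ω)) μ
  have hfirst : ∀ j, condEntropy (fun ω => (O (t + 1 + 1 + j) ω).1)
      (fun ω => (U (t + 1) ω, segment O (t + 1 + 1) j ω)) μ = stateEntropy O U μ 0 j := fun j =>
    stateEntropy_eq hO hU hstat (t + 1) j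
  have hmid : ∀ j, condEntropy (fun ω => (O (t + 1 + 1 + j) ω).1)
      (fun ω => ((U (t + 1) ω, segment O (t + 1 + 1) j ω), O (t + 1) ω)) μ = a j := fun j =>
    condEntropy_congr_of_comp (hY j) (((hU _).prodMk (hS j)).prodMk (hO _))
      (((hU _).prodMk (hO _)).prodMk (hS j)) (f := fun p => ((p.1.1, p.2), p.1.2)) (by fun_prop)
      (fun _ => rfl) (g := fun p => ((p.1.1, p.2), p.1.2)) (by fun_prop) fun _ => rfl
  have hlast : ∀ j, condEntropy (fun ω => (O (t + 1 + 1 + j) ω).1)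
      (fun ω => (((U (t + 1) ω, O (t + 1) ω), segment O (t + 1 + 1) j ω), U t ω)) μ
        = stateEntropy O U μ 0 (j + 1) := fun j => by
    rw [h.condEntropy_update, stateEntropy_eq hO hU hstat]
  have hle₁ : ∀ j, stateEntropy O U μ 0 (j + 1) ≤ a j := fun j => by
    rw [← hlast]
    exact condEntropy_le_comp (hY j) ((((hU _).prodMk (hO _)).prodMk (hS j)).prodMk (hU t))
      (g := Prod.fst) measurable_fst
  have hle₂ : ∀ j, a j ≤ stateEntropy O U μ 0 j := fun j => by
    rw [← hfirst]
    exact condEntropy_le_comp (hY j) (((hU _).prodMk (hO _)).prodMk (hS j))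
      (g := fun p => (p.1.1, p.2)) (by fun_prop)
  rw [show t + 2 = t + 1 + 1 from rfl, hF, hI, ← Finset.sum_add_distrib,
    ← Finset.sum_range_sub', ENNReal.ofReal_sum_of_nonneg fun j _ =>
      sub_nonneg.2 ((hle₁ j).trans (hle₂ j))]
  refine Finset.sum_congr rfl fun j _ => ?_
  rw [hfirst, hmid, hlast, ← ENNReal.ofReal_add (sub_nonneg.2 (hle₁ j)) (sub_nonneg.2 (hle₂ j))]
  congr 1
  ring

/-- Forgetting and implasticity together amount to what the current state leaves uncertain about the
next label, less what a state in the remote past followed by all later data leaves uncertain. -/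
lemma IsSupervisedInteraction.forgetting_add_implasticity
    (h : IsSupervisedInteraction μ ρ π ψ O A U)
    (hstat : IsStationary (fun t ω => (U t ω, O t ω)) μ)
    (hX : ∀ t : ℕ, IndepFun (fun ω => (O (t + 1) ω).2)
      (fun ω => (history O t ω, (O (t + 1) ω).1)) μ) {l : ℝ}
    (hl : Tendsto (stateEntropy O U μ 0) atTop (𝓝 l)) (t : ℕ) :
    forgetting O U μ (t + 1) + implasticity O U μ (t + 1)
      = ENNReal.ofReal (stateEntropy O U μ 0 0 - l) := by
  have hO := h.measurable_obs
  have hU := h.measurable_state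
  have hfut : Measurable (future O (t + 2)) := measurable_pi_lambda _ fun _ => hO _
  have hlim := (tendsto_condMutualInfo_initialSegment (μ := μ) hfut (hU t)
    ((hU (t + 1)).prodMk (hO (t + 1)))).add
    (tendsto_condMutualInfo_initialSegment (μ := μ) hfut (hO (t + 1)) (hU (t + 1)))
  refine tendsto_nhds_unique hlim ?_
  refine (ENNReal.tendsto_ofReal (tendsto_const_nhds.sub hl)).congr fun n => ?_
  exact (h.condMutualInfo_add_condMutualInfo hstat hX t n).symm

end Telescoping

end ContinualSL

theorem mainTheorem2 {Ω 𝒳 𝒴 𝒰 : Type*} [MeasurableSpace Ω]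
    [MeasurableSpace 𝒳] [StandardBorelSpace 𝒳] [Nonempty 𝒳]
    [MeasurableSpace 𝒴] [MeasurableSingletonClass 𝒴] [Fintype 𝒴] [Nonempty 𝒴]
    [MeasurableSpace 𝒰] [StandardBorelSpace 𝒰] [Nonempty 𝒰]
    (μ : Measure Ω) [IsProbabilityMeasure μ]
    (ρ : ∀ t : ℕ, Kernel (Finset.Iic t → 𝒴 × 𝒳) (𝒴 × 𝒳)) [∀ t, IsMarkovKernel (ρ t)]
    (π : Kernel 𝒰 (stdSimplex ℝ 𝒴)) [IsMarkovKernel π]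
    (ψ : Kernel (𝒰 × stdSimplex ℝ 𝒴 × (𝒴 × 𝒳)) 𝒰) [IsMarkovKernel ψ]
    (O : ℕ → Ω → 𝒴 × 𝒳) (A : ℕ → Ω → stdSimplex ℝ 𝒴) (U : ℕ → Ω → 𝒰)
    (hint : ContinualSL.IsSupervisedInteraction μ ρ π ψ O A U)
    (hstat : ContinualSL.IsStationary (fun t ω => (U t ω, O t ω)) μ)
    (hX : ∀ t : ℕ, IndepFun (fun ω => (O (t + 1) ω).2)
      (fun ω => (ContinualSL.history O t ω, (O (t + 1) ω).1)) μ) :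
    ∃ L : ℝ≥0,
      Tendsto (fun t => ContinualSL.informationalError O U μ t) atTop (𝓝 (L : ℝ≥0∞)) ∧
      Tendsto (fun t => ContinualSL.forgetting O U μ t + ContinualSL.implasticity O U μ t)
        atTop (𝓝 (L : ℝ≥0∞)) := by
  have hO := hint.measurable_obs
  have hU := hint.measurable_state
  set g := ContinualSL.dataEntropy O μ 0
  set s := ContinualSL.stateEntropy O U μ 0
  obtain ⟨l, hg⟩ : ∃ l, Tendsto g atTop (𝓝 l) :=
    ⟨_, tendsto_atTop_ciInf (ContinualSL.dataEntropy_antitone hO hU hstat)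
      ⟨0, by rintro _ ⟨n, rfl⟩; exact ContinualSL.condEntropy_nonneg⟩⟩
  have hg' : Tendsto (fun n => g (n + 1)) atTop (𝓝 l) := hg.comp (tendsto_add_atTop_nat 1)
  have hs : Tendsto s atTop (𝓝 l) := tendsto_of_tendsto_of_tendsto_of_le_of_le hg' hg
    hint.dataEntropy_le_stateEntropy (ContinualSL.stateEntropy_le_dataEntropy hO hU hstat)
  refine ⟨(s 0 - l).toNNReal, ?_, ?_⟩
  · refine (ENNReal.tendsto_ofReal (tendsto_const_nhds.sub hg')).congr fun t => ?_
    rw [hint.informationalError_eq, ContinualSL.stateEntropy_eq hO hU hstat]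
  · -- from time `1` on, the sum is constant
    rw [← tendsto_add_atTop_iff_nat 1]
    exact tendsto_const_nhds.congr fun t =>
      (hint.forgetting_add_implasticity hstat hX hs t).symm
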